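/- Let $D$ be the regular hyperbolic decagon with all interior angles equal to $2\pi/5$. Label its boundary, read counter-clockwise, by $abcdeabcde$, where the first five edges are oriented counter-clockwise and the last five clockwise. Let $\mathcal{D}$ be the labelled tiling of the hyperbolic plane whose tiles are the translates of $D$ under the group generated by the side pairings of $D$, that is, by the orientation-preserving isometries that carry an edge of $D$ to the opposite edge, which has the same label, respecting the orientations of the two edges. (This group is the fundamental group of the closed orientable surface of genus two.) An edge path in the one-skeleton of $\mathcal{D}$ spells a word in the letters $a,b,c,d,e,\bar a,\bar b,\bar c,\bar d,\bar e$, where a bar means that an edge is traversed against its orientation. The following ten words are called bad turns: $$edcba,\ \bar b\bar a edc,\ \bar d\bar c\bar b\bar a e,\ a\bar e\bar d\bar c\bar b,\ cba\bar e\bar d,\ \bar a\bar b\bar c\bar d\bar e,\ \bar c\bar d\bar e ab,\ \bar e abcd,\ bcde\bar a,\ de\bar a\bar b\bar c.$$ An edge path is well-tempered if the word it spells is freely reduced and contains no bad turn as a block of consecutive letters. For any ordered pair of vertices of $\mathcal{D}$ there is a unique well-tempered path from the first to the second. Every well-tempered path is geodesic in the one-skeleton, that is, it has the least number of edges among all paths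 with the same endpoints. Subpaths and inverses of well-tempered paths are well-tempered. Finally, well-tempered paths are locally detectable: a path is well-tempered if and only if all its subpaths of length at most five are, and a path of length at least five is well-tempered if and only if all its subpaths of length exactly five are. -/

import Mathlib

open scoped MatrixGroups

namespace DecagonTiling

open UpperHalfPlane

noncomputable section

/-! ### The regular decagon with interior angles `2π/5`

The hyperbolic plane is the upper half plane `ℍ`, on which `SL(2, ℝ)` acts by orientation
preserving isometries.  The decagon is centred at the point `i`. -/

/-- The rotation of `ℍ` about the point `i` through the angle `θ`, counter-clockwise. -/
def rotation (θ : ℝ) : SL(2, ℝ) :=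
  ⟨!![Real.cos (θ / 2), Real.sin (θ / 2); -Real.sin (θ / 2), Real.cos (θ / 2)], by
    rw [Matrix.det_fin_two_of]; linear_combination Real.cos_sq_add_sin_sq (θ / 2)⟩

/-- The circumradius of the regular decagon with angles `2π/5`.  Half a side of the decagon, its
centre and a vertex span a right triangle whose other angles are `π/10` (at the centre) and `π/5`
(at the vertex), so that `cosh` of its hypotenuse is `cot (π/10) * cot (π/5)`.
See `interiorAngle_decagonVertex`. -/
def circumradius : ℝ := Real.arcosh (Real.cot (Real.pi / 10) * Real.cot (Real.pi / 5))

/-- The point of `ℍ` at distance `circumradius` straight above `i`. -/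
def topVertex : ℍ := ⟨⟨0, Real.exp circumradius⟩, Real.exp_pos _⟩

/-- The vertices `v 0, v 1, …, v 9` of the decagon in counter-clockwise order; the index is read
modulo `10`.  The sides are the geodesic segments from `v k` to `v (k + 1)`. -/
def decagonVertex (k : ℕ) : ℍ := rotation (k * (Real.pi / 5)) • topVertex

/-- The angle at `z` between the geodesics from `z` to `w₁` and from `z` to `w₂`: the isometry
`w ↦ (w - z) / (w - z̄)` onto the Poincaré disc takes `z` to the centre, and the two geodesics to
Euclidean radii. -/
def angleAt (z w₁ w₂ : ℍ) : ℝ :=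
  InnerProductGeometry.angle
    (((w₁ : ℂ) - z) / ((w₁ : ℂ) - (starRingEnd ℂ) z))
    (((w₂ : ℂ) - z) / ((w₂ : ℂ) - (starRingEnd ℂ) z))

theorem one_lt_cosh_circumradius : 1 < Real.cot (Real.pi / 10) * Real.cot (Real.pi / 5) := by
  have key : ∀ x : ℝ, 0 < x → x < Real.pi / 4 → 1 < Real.cot x := by
    intro x hx hx'
    have h := Real.tan_lt_tan_of_lt_of_lt_pi_div_two (x := x) (y := Real.pi / 4)
      (by linarith) (by linarith [Real.pi_pos]) hx'
    rw [Real.tan_pi_div_four] at h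
    have h0 := Real.tan_pos_of_pos_of_lt_pi_div_two hx (by linarith [Real.pi_pos])
    rw [← Real.tan_inv_eq_cot]
    exact (one_lt_inv₀ h0).2 h
  have h1 := key (Real.pi / 10) (by positivity) (by linarith [Real.pi_pos])
  have h2 := key (Real.pi / 5) (by positivity) (by linarith [Real.pi_pos])
  nlinarith

theorem rotation_add (α β : ℝ) : rotation (α + β) = rotation α * rotation β := by
  apply Subtype.ext
  rw [Matrix.SpecialLinearGroup.coe_mul]
  simp only [rotation, Matrix.mul_fin_two, add_div, Real.cos_add, Real.sin_add]
  congr 1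
  ext i j
  fin_cases i <;> fin_cases j <;> simp <;> ring

theorem angleAt_smul (g : SL(2, ℝ)) (z w₁ w₂ : ℍ) :
    angleAt (g • z) (g • w₁) (g • w₂) = angleAt z w₁ w₂ := by
  have hdet : ((g 0 0 : ℝ) : ℂ) * (g 1 1 : ℝ) - (g 0 1 : ℝ) * (g 1 0 : ℝ) = 1 := by
    have := g.det_coe
    rw [Matrix.det_fin_two] at this
    exact_mod_cast this
  have hne : ∀ x : ℂ, x.im ≠ 0 → ((g 1 0 : ℝ) : ℂ) * x + (g 1 1 : ℝ) ≠ 0 := by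
    intro x hx h
    have him := congrArg Complex.im h
    have hre := congrArg Complex.re h
    simp [hx] at him hre
    simp [him] at hre
    simp [him, hre] at hdet
  have hz : (z : ℂ).im ≠ 0 := z.im_pos.ne'
  have hz' : ((starRingEnd ℂ) (z : ℂ)).im ≠ 0 := by simpa using hz
  have key : ∀ w : ℍ,
      (((g • w : ℍ) : ℂ) - (g • z : ℍ)) / (((g • w : ℍ) : ℂ) - (starRingEnd ℂ) (g • z : ℍ)) =
      ((((g 1 0 : ℝ) : ℂ) * (starRingEnd ℂ) (z : ℂ) + (g 1 1 : ℝ)) /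
        (((g 1 0 : ℝ) : ℂ) * z + (g 1 1 : ℝ))) *
        (((w : ℂ) - z) / ((w : ℂ) - (starRingEnd ℂ) z)) := by
    intro w
    have hw : (w : ℂ).im ≠ 0 := w.im_pos.ne'
    have h1 := hne _ hw
    have h2 := hne _ hz
    have h3 := hne _ hz'
    have h4 : (w : ℂ) - (starRingEnd ℂ) (z : ℂ) ≠ 0 := by
      intro h
      have := congrArg Complex.im h
      simp at this
      linarith [w.im_pos, z.im_pos]
    rw [coe_specialLinearGroup_apply, coe_specialLinearGroup_apply]
    simp only [map_div₀, map_add, map_mul, Complex.conj_ofReal, Algebra.algebraMap_self,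
      RingHom.id_apply]
    rw [div_sub_div _ _ h1 h2, div_sub_div _ _ h1 h3, div_div_div_eq, div_mul_div_comm,
      div_eq_div_iff]
    · ring
    · refine mul_ne_zero (mul_ne_zero h1 h2) ?_
      have : (((g 0 0 : ℝ) : ℂ) * w + (g 0 1 : ℝ)) *
          (((g 1 0 : ℝ) : ℂ) * (starRingEnd ℂ) (z : ℂ) + (g 1 1 : ℝ)) -
          (((g 1 0 : ℝ) : ℂ) * w + (g 1 1 : ℝ)) *
          (((g 0 0 : ℝ) : ℂ) * (starRingEnd ℂ) (z : ℂ) + (g 0 1 : ℝ)) =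
          (w : ℂ) - (starRingEnd ℂ) (z : ℂ) := by
        linear_combination ((w : ℂ) - (starRingEnd ℂ) (z : ℂ)) * hdet
      rwa [this]
    · exact mul_ne_zero h2 h4
  unfold angleAt
  rw [key w₁, key w₂]
  exact Complex.angle_mul_left (div_ne_zero (hne _ hz') (hne _ hz)) _ _

theorem angleAt_topVertex :
    angleAt topVertex (rotation (-(Real.pi / 5)) • topVertex) (rotation (Real.pi / 5) • topVertex) =
      2 * Real.pi / 5 := by
  have hpi := Real.pi_pos
  set y := Real.exp circumradius with hy
  set t := Real.pi / 10 with ht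
  have hy0 : 0 < y := Real.exp_pos _
  have hR : 0 < circumradius := Real.arcosh_pos one_lt_cosh_circumradius
  have hs : 0 < Real.sin t := Real.sin_pos_of_pos_of_lt_pi (by positivity) (by linarith)
  have hc : 0 < Real.cos t := Real.cos_pos_of_mem_Ioo ⟨by linarith, by linarith⟩
  have hS : 0 < Real.sin (Real.pi / 5) :=
    Real.sin_pos_of_pos_of_lt_pi (by positivity) (by linarith)
  have hy1 : 1 < y := Real.one_lt_exp_iff.2 hR
  have hcosh : Real.sin t * (1 + y ^ 2) * Real.sin (Real.pi / 5) =
      2 * y * Real.cos t * Real.cos (Real.pi / 5) := by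
    have h := Real.cosh_arcosh one_lt_cosh_circumradius.le
    rw [← circumradius, Real.cosh_eq, Real.exp_neg, ← hy, Real.cot_eq_cos_div_sin,
      Real.cot_eq_cos_div_sin, ← ht] at h
    field_simp at h
    linarith
  have hcoshC : (Real.sin t : ℂ) * (1 + (y : ℂ) ^ 2) * Real.sin (Real.pi / 5) =
      2 * y * Real.cos t * Real.cos (Real.pi / 5) := by exact_mod_cast hcosh
  have hK : Real.sin t * (1 - y ^ 2) * Real.sin (Real.pi / 5) / (2 * y * Real.cos t) ≠ 0 := by
    have : 1 - y ^ 2 ≠ 0 := by nlinarith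
    positivity
  have key : ∀ σ : ℝ, σ ^ 2 = 1 →
      (((rotation (σ * (Real.pi / 5)) • topVertex : ℍ) : ℂ) - topVertex) /
        (((rotation (σ * (Real.pi / 5)) • topVertex : ℍ) : ℂ) - (starRingEnd ℂ) topVertex) =
      ((Real.sin t * (1 - y ^ 2) * Real.sin (Real.pi / 5) / (2 * y * Real.cos t) : ℝ) : ℂ) *
        Complex.exp ((-σ * (Real.pi / 5) : ℝ) * Complex.I) := by
    intro σ hσ
    have hsin : Real.sin (σ * (Real.pi / 5) / 2) = σ * Real.sin t ∧
        Real.cos (σ * (Real.pi / 5) / 2) = Real.cos t ∧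
        Real.sin (-σ * (Real.pi / 5)) = -σ * Real.sin (Real.pi / 5) ∧
        Real.cos (-σ * (Real.pi / 5)) = Real.cos (Real.pi / 5) := by
      have h5 : Real.pi / 5 / 2 = t := by rw [ht]; ring
      rcases (by simpa using hσ : σ = 1 ∨ σ = -1) with rfl | rfl
      · simp [h5]
      · simp [neg_div, h5]
    obtain ⟨e1, e2, e3, e4⟩ := hsin
    have hbar : (starRingEnd ℂ) (topVertex : ℂ) = -(topVertex : ℂ) := by
      apply Complex.ext <;> simp [topVertex]
    have htop : (topVertex : ℂ) = Complex.I * y := by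
      apply Complex.ext <;> simp [topVertex, hy, Complex.exp_ofReal_re]
    have hcoe : ((rotation (σ * (Real.pi / 5)) • topVertex : ℍ) : ℂ) =
        (Real.cos t * (Complex.I * y) + σ * Real.sin t) /
          (-(σ * Real.sin t) * (Complex.I * y) + Real.cos t) := by
      rw [coe_specialLinearGroup_apply, htop]
      simp only [rotation, Algebra.algebraMap_self, RingHom.id_apply, e1, e2]
      simp
    rw [hbar, hcoe, htop, Complex.exp_mul_I, ← Complex.ofReal_cos, ← Complex.ofReal_sin, e3, e4]
    have hSC : (Real.cos (Real.pi / 5) : ℂ) ^ 2 + (Real.sin (Real.pi / 5) : ℂ) ^ 2 = 1 := by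
      exact_mod_cast Real.cos_sq_add_sin_sq (Real.pi / 5)
    have hσC : (σ : ℂ) ^ 2 = 1 := by exact_mod_cast hσ
    have hy0C : (y : ℂ) ≠ 0 := by exact_mod_cast hy0.ne'
    have hcC : (Real.cos t : ℂ) ≠ 0 := by exact_mod_cast hc.ne'
    have hd1 : (-((σ : ℂ) * Real.sin t) * (Complex.I * y) + Real.cos t) ≠ 0 := by
      intro h
      have := congrArg Complex.re h
      simp [-Complex.ofReal_cos, -Complex.ofReal_sin] at this
      exact hc.ne' this
    have hd2 : (σ : ℂ) * Real.sin t * (1 + (y : ℂ) ^ 2) + 2 * Real.cos t * Complex.I * y ≠ 0 := by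
      intro h
      have := congrArg Complex.im h
      simp [-Complex.ofReal_cos, -Complex.ofReal_sin, ← Complex.ofReal_pow] at this
      rcases this with h | h
      · exact hc.ne' h
      · exact hy0.ne' h
    generalize Real.sin t = s at *
    generalize Real.cos t = c at *
    generalize Real.sin (Real.pi / 5) = S at *
    generalize Real.cos (Real.pi / 5) = C at *
    have hI := Complex.I_sq
    have e5 : ((c : ℂ) * (Complex.I * y) + σ * s) / (-((σ : ℂ) * s) * (Complex.I * y) + c) -
        Complex.I * y = (σ * s * (1 - (y : ℂ) ^ 2)) /
          (-((σ : ℂ) * s) * (Complex.I * y) + c) := by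
      rw [div_sub' hd1]
      congr 1
      linear_combination (σ * s * (y : ℂ) ^ 2) * hI
    have e6 : ((c : ℂ) * (Complex.I * y) + σ * s) / (-((σ : ℂ) * s) * (Complex.I * y) + c) -
        -(Complex.I * y) = (σ * s * (1 + (y : ℂ) ^ 2) + 2 * c * Complex.I * y) /
          (-((σ : ℂ) * s) * (Complex.I * y) + c) := by
      rw [div_sub' hd1]
      congr 1
      linear_combination (-σ * s * (y : ℂ) ^ 2) * hI
    rw [e5, e6, div_div_div_cancel_right₀ hd1, div_eq_iff hd2]
    have e7 : ((C : ℂ) + -σ * S * Complex.I) * S *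
        (σ * s * (1 + (y : ℂ) ^ 2) + 2 * c * Complex.I * y) = 2 * y * c * σ := by
      linear_combination ((C : ℂ) + -σ * S * Complex.I) * σ * hcoshC +
        2 * y * c * σ * hSC - 2 * y * c * σ * S ^ 2 * hI -
        2 * y * c * S * C * Complex.I * hσC
    push_cast
    rw [div_mul_eq_mul_div, div_mul_eq_mul_div, eq_div_iff (by simp [hy0C, hcC])]
    linear_combination (-(s : ℂ) * (1 - (y : ℂ) ^ 2)) * e7
  unfold angleAt
  have h1 := key (-1) (by norm_num)
  have h2 := key 1 (by norm_num)
  rw [neg_one_mul] at h1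
  rw [one_mul] at h2
  rw [h1, h2, Complex.angle_mul_left (by exact_mod_cast hK), Complex.angle_exp_exp,
    (toIocMod_eq_self _).2, abs_of_pos]
  · ring
  · linarith
  · constructor <;> linarith

/-- The decagon has interior angle `2π/5` at every vertex. -/
theorem interiorAngle_decagonVertex (k : ℕ) :
    angleAt (decagonVertex (k + 1)) (decagonVertex k) (decagonVertex (k + 2)) =
      2 * Real.pi / 5 := by
  rw [← angleAt_topVertex, ← angleAt_smul (rotation ((k + 1 : ℕ) * (Real.pi / 5))) topVertex,
    smul_smul, smul_smul, ← rotation_add, ← rotation_add]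
  unfold decagonVertex
  congr 3 <;> push_cast <;> ring_nf

/-! ### The labelled tiling

The boundary of the decagon, read counter-clockwise from `v 0`, is labelled `a b c d e a b c d e`
(the labels `a, …, e` are the elements `0, …, 4` of `Fin 5`).  The first five sides are oriented
counter-clockwise and the last five clockwise: for `i : Fin 5` the two sides with label `i` are
`v i → v (i + 1)` and `v (i + 6) → v (i + 5)`. -/

/-- The group of deck transformations of the tiling, generated by the side pairings: the orientation
preserving isometries carrying the side `v (i + 6) → v (i + 5)` to the side `v i → v (i + 1)` with
the same label, respecting the orientations of the sides.  They take the decagon to its neighbour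
across the second side, and the tiles of the tiling are the translates of the decagon by this group.
-/
def deckGroup : Subgroup SL(2, ℝ) :=
  Subgroup.closure {g | ∃ i : Fin 5,
    g • decagonVertex (i + 6) = decagonVertex i ∧ g • decagonVertex (i + 5) = decagonVertex (i + 1)}

/-- The vertices of the tiling. -/
def Vertex : Type := {p : ℍ // ∃ g ∈ deckGroup, ∃ k : ℕ, p = g • decagonVertex k}

/-- The tiling has an edge with label `i`, oriented from `p` to `q`: the geodesic segment from
`p` to `q` is a translate of one of the two sides of the decagon with label `i`. -/
def IsEdge (i : Fin 5) (p q : ℍ) : Prop :=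
  ∃ g ∈ deckGroup,
    (p = g • decagonVertex i ∧ q = g • decagonVertex (i + 1)) ∨
    (p = g • decagonVertex (i + 6) ∧ q = g • decagonVertex (i + 5))

/-- The alphabet `{a, b, c, d, e, ā, b̄, c̄, d̄, ē}`: the letter `(i, true)` is the label `i`, and
`(i, false)` is its formal inverse. -/
abbrev Letter : Type := Fin 5 × Bool

/-- A step from `p` to `q` along an edge of the tiling, reading the given letter: the label of the
edge if it is traversed along its orientation, and the inverse letter otherwise. -/
def IsStep : Letter → ℍ → ℍ → Prop
  | (i, true), p, q => IsEdge i p q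
  | (i, false), p, q => IsEdge i q p

theorem IsStep.inv {i : Fin 5} {s : Bool} {p q : ℍ} (h : IsStep (i, s) p q) :
    IsStep (i, !s) q p := by
  cases s <;> exact h

/-- The labelled one-skeleton of the tiling, every edge being traversable in both directions. Thus
`Quiver.Path p q` is the type of edge paths in the one-skeleton from `p` to `q`. -/
instance : Quiver Vertex where
  Hom p q := {l : Letter // IsStep l p.1 q.1}

instance : Quiver.HasInvolutiveReverse Vertex where
  reverse' e := ⟨(e.1.1, !e.1.2), IsStep.inv e.2⟩
  inv' e := Subtype.ext (Prod.ext rfl (Bool.not_not e.1.2))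

/-- The word in the alphabet of letters read along a path. -/
def word {p : Vertex} : {q : Vertex} → Quiver.Path p q → List Letter
  | _, Quiver.Path.nil => []
  | _, Quiver.Path.cons γ e => word γ ++ [e.1]

/-- The ten bad turns; a capital letter denotes an inverse. -/
def badTurns : List (List Letter) :=
  let a : Letter := (0, true)
  let b : Letter := (1, true)
  let c : Letter := (2, true)
  let d : Letter := (3, true)
  let e : Letter := (4, true)
  let A : Letter := (0, false)
  let B : Letter := (1, false)
  let C : Letter := (2, false)
  let D : Letter := (3, false)
  let E : Letter := (4, false)
  [[e, d, c, b, a], [B, A, e, d, c], [D, C, B, A, e], [a, E, D, C, B], [c, b, a, E, D],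
   [A, B, C, D, E], [C, D, E, a, b], [E, a, b, c, d], [b, c, d, e, A], [d, e, A, B, C]]

/-- A path is well-tempered if its word is freely reduced and contains no bad turn as a block of
consecutive letters. -/
def WellTempered {p q : Vertex} (γ : Quiver.Path p q) : Prop :=
  FreeGroup.IsReduced (word γ) ∧ ∀ t ∈ badTurns, ¬ t <:+: word γ

/-- A path is geodesic if no path with the same endpoints has fewer edges. -/
def IsGeodesic {p q : Vertex} (γ : Quiver.Path p q) : Prop :=
  ∀ δ : Quiver.Path p q, γ.length ≤ δ.length

/-- `β` is a subpath of `γ`: a run of consecutive edges of `γ`. -/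
def IsSubpath {p q r s : Vertex} (β : Quiver.Path p q) (γ : Quiver.Path r s) : Prop :=
  ∃ (α : Quiver.Path r p) (δ : Quiver.Path q s), γ = (α.comp β).comp δ

end

end DecagonTiling

namespace DecagonTiling

open UpperHalfPlane
open Real (goldenRatio goldenRatio_sq one_lt_goldenRatio)

/-! ### Hyperbolic distances along rotations -/

/-! Number the letters modulo 10 around the decagon. A walk in the one-skeleton is then a product of
isometries `step m`, built from the rotation `rho` of the decagon and the rotation `sigma` about one
of its vertices. These satisfy `rho ^ 10 = sigma ^ 5 = (rho * sigma) ^ 2 = 1`. A bad turn is a half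
circuit of a decagon, clockwise from one kind of vertex and counter-clockwise from the other; the
complementary half circuit is allowed.

Uniqueness is metric. Fix a point `q` and measure each vertex by the hyperbolic cosine of its
distance to `q`. Under a rotation this varies sinusoidally, so it satisfies linear relations with
coefficients in the golden ratio: one for four consecutive vertices of a decagon (`height_decagon`),
one for a vertex and three consecutive neighbours (`height_star`). Perpendicular bisectors cut out
five disjoint cones at each vertex, one per outgoing edge (`Cone.eq`). A nonempty admissible path
ends in the cone of its first letter (`Admissible.cone`): follow the path around a decagon until it
leaves, which takes at most four edges because there is no bad turn; by induction its end lies on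
the far side as seen from there, and the decagon relations transport this to the starting vertex. So
the end determines the first letter, hence the whole word.

Existence and minimality are algebraic. Cancelling inverse letters and exchanging a bad half circuit
for the other half never lengthens a word (`Admissible.exists_cons`). Every path can thus be
replaced by a well-tempered one that is no longer, and by uniqueness that is always the same path.

The polygons are not assumed to tessellate. Frames `corner g k` at the vertices are matched by the
side pairings, and uniqueness of admissible words itself shows that a vertex determines its frame
(`IsFrame.unique`), so paths from a vertex correspond to words. The remaining claims hold because
the forbidden patterns have length two or five and are closed under inversion. -/

theorem rotation_zero : rotation 0 = 1 := by
  apply Subtype.ext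
  ext i j
  fin_cases i <;> fin_cases j <;> simp [rotation]

theorem rotation_pow (θ : ℝ) (n : ℕ) : rotation θ ^ n = rotation (n * θ) := by
  induction n with
  | zero => simp [rotation_zero]
  | succ n ih => rw [pow_succ, ih, ← rotation_add]; congr 1; push_cast; ring

theorem rotation_inv (θ : ℝ) : (rotation θ)⁻¹ = rotation (-θ) := by
  rw [inv_eq_iff_mul_eq_one, ← rotation_add, add_neg_cancel, rotation_zero]

theorem det_eq_one (g : SL(2, ℝ)) : g 0 0 * g 1 1 - g 0 1 * g 1 0 = 1 := by
  have := g.det_coe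
  rwa [Matrix.det_fin_two] at this

theorem denom_coe_ne_zero (g : SL(2, ℝ)) (z : ℍ) :
    ((g 1 0 : ℝ) : ℂ) * z + (g 1 1 : ℝ) ≠ 0 := by
  intro h
  have hdet := det_eq_one g
  have him := congrArg Complex.im h
  have hre := congrArg Complex.re h
  simp [z.im_pos.ne'] at him hre
  simp [him] at hre
  simp [him, hre] at hdet

theorem coe_smul_mul (g : SL(2, ℝ)) (z : ℍ) :
    ((g • z : ℍ) : ℂ) * ((g 1 0 : ℝ) * (z : ℂ) + (g 1 1 : ℝ)) =
      (g 0 0 : ℝ) * (z : ℂ) + (g 0 1 : ℝ) := by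
  rw [coe_specialLinearGroup_apply]
  exact div_mul_cancel₀ _ (denom_coe_ne_zero g z)

theorem smul_eq_iff (g : SL(2, ℝ)) (z w : ℍ) :
    g • z = w ↔ (w : ℂ) * ((g 1 0 : ℝ) * (z : ℂ) + (g 1 1 : ℝ)) =
      (g 0 0 : ℝ) * (z : ℂ) + (g 0 1 : ℝ) := by
  rw [← coe_smul_mul g z, mul_left_inj' (denom_coe_ne_zero g z), UpperHalfPlane.ext_iff, eq_comm]

theorem neg_one_smul_eq (z : ℍ) : (-1 : SL(2, ℝ)) • z = z := by
  rw [smul_eq_iff]; simp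

/-- An orientation preserving isometry with two fixed points is the identity. -/
theorem smul_eq_self_of_two_fixed {g : SL(2, ℝ)} {z w : ℍ} (hzw : z ≠ w) (hz : g • z = z)
    (hw : g • w = w) (p : ℍ) : g • p = p := by
  have key : ∀ z : ℍ, g • z = z →
      2 * g 1 0 * z.re = g 0 0 - g 1 1 ∧ -(g 1 0 * (z.re ^ 2 + z.im ^ 2)) = g 0 1 := by
    intro z hz
    rw [smul_eq_iff] at hz
    have hre := congrArg Complex.re hz
    have him := congrArg Complex.im hz
    simp at hre him
    have hy := z.im_pos
    have h1 : 2 * g 1 0 * z.re = g 0 0 - g 1 1 := by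
      apply mul_right_cancel₀ hy.ne'
      linear_combination him
    exact ⟨h1, by linear_combination hre - z.re * h1⟩
  obtain ⟨h1, h2⟩ := key z hz
  obtain ⟨h3, h4⟩ := key w hw
  have hc : g 1 0 = 0 := by
    by_contra hc
    apply hzw
    have hx : z.re = w.re := by
      apply mul_left_cancel₀ hc; linear_combination (h1 - h3) / 2
    have hy : z.im ^ 2 = w.im ^ 2 := by
      apply mul_left_cancel₀ hc
      rw [hx] at h2
      linear_combination h4 - h2
    have hy' := (sq_eq_sq₀ z.im_pos.le w.im_pos.le).1 hy
    exact UpperHalfPlane.ext (Complex.ext hx hy')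
  rw [smul_eq_iff]
  have hb : g 0 1 = 0 := by rw [← h2, hc]; ring
  have had : g 0 0 = g 1 1 := by rw [hc] at h1; linarith
  rw [hb, hc, had]
  simp; ring

theorem cosh_dist_smul (g : SL(2, ℝ)) (z w : ℍ) :
    Real.cosh (dist (g • z) w) =
      (((g 0 0 * z.re + g 0 1) ^ 2 + (g 0 0 * z.im) ^ 2) -
        2 * w.re * ((g 0 0 * z.re + g 0 1) * (g 1 0 * z.re + g 1 1) + g 0 0 * g 1 0 * z.im ^ 2) +
        (w.re ^ 2 + w.im ^ 2) * ((g 1 0 * z.re + g 1 1) ^ 2 + (g 1 0 * z.im) ^ 2)) /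
        (2 * z.im * w.im) := by
  have hdet := det_eq_one g
  have h := coe_smul_mul g z
  have hre := congrArg Complex.re h
  have him := congrArg Complex.im h
  simp at hre him
  rw [cosh_dist']
  have hP := (g • z).im_pos
  have hz := z.im_pos
  have hw := w.im_pos
  generalize (g • z).re = X at *
  generalize (g • z).im = Y at *
  generalize z.re = x at *
  generalize z.im = y at *
  generalize w.re = u at *
  generalize w.im = v at *
  generalize g 0 0 = a at *
  generalize g 0 1 = b at *
  generalize g 1 0 = c at *
  generalize g 1 1 = d at *
  have e1 : Y * ((c * x + d) ^ 2 + (c * y) ^ 2) = y := by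
    linear_combination (c * x + d) * him - c * y * hre + y * hdet
  have e2 : X * ((c * x + d) ^ 2 + (c * y) ^ 2) = (a * x + b) * (c * x + d) + a * c * y ^ 2 := by
    linear_combination (c * x + d) * hre + c * y * him
  have e3 : (X ^ 2 + Y ^ 2) * ((c * x + d) ^ 2 + (c * y) ^ 2) = (a * x + b) ^ 2 + (a * y) ^ 2 := by
    linear_combination (X * (c * x + d) - Y * c * y + a * x + b) * hre +
      (X * c * y + Y * (c * x + d) + a * y) * him
  rw [← e3, ← e2, div_eq_div_iff (by positivity) (by positivity)]
  linear_combination -(2 * v * (X ^ 2 + Y ^ 2 - 2 * u * X + u ^ 2 + v ^ 2)) * e1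

/-- The distance to a fixed point varies sinusoidally as a point is rotated. -/
theorem cosh_dist_rotation (z w : ℍ) : ∃ B E : ℝ, ∀ θ : ℝ,
    Real.cosh (dist (rotation θ • z) w) =
      Real.cosh (dist z I) * Real.cosh (dist w I) + B * Real.cos θ + E * Real.sin θ := by
  have hz := z.im_pos
  have hw := w.im_pos
  refine ⟨((w.re ^ 2 + w.im ^ 2 - 1) * (1 - z.re ^ 2 - z.im ^ 2) / 2 - 2 * w.re * z.re) /
      (2 * z.im * w.im),
    (z.re * (1 - w.re ^ 2 - w.im ^ 2) - w.re * (1 - z.re ^ 2 - z.im ^ 2)) / (2 * z.im * w.im),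
    fun θ => ?_⟩
  rw [cosh_dist_smul, cosh_dist' z, cosh_dist' w]
  obtain ⟨t, rfl⟩ : ∃ t, θ = 2 * t := ⟨θ / 2, by ring⟩
  have ht : 2 * t / 2 = t := by ring
  have hsq := Real.sin_sq_add_cos_sq t
  simp only [rotation, ht, Matrix.SpecialLinearGroup.coe_mk, Matrix.of_apply, Matrix.cons_val',
    Matrix.cons_val_zero, Matrix.cons_val_one, Matrix.cons_val_fin_one, I_re, I_im,
    Real.cos_two_mul, Real.sin_two_mul]
  generalize Real.cos t = c at *
  generalize Real.sin t = s at *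
  field_simp
  have hs : s ^ 2 = 1 - c ^ 2 := by linarith
  ring_nf
  simp only [hs]
  ring

/-! ### The rotations generating the symmetries of the tiling -/

/-- The translation along the imaginary axis taking `I` to `topVertex`. -/
noncomputable def topTranslation : SL(2, ℝ) :=
  ⟨!![Real.exp (circumradius / 2), 0; 0, Real.exp (-(circumradius / 2))], by
    rw [Matrix.det_fin_two_of, ← Real.exp_add]; simp⟩

theorem topTranslation_smul_I : topTranslation • I = topVertex := by
  rw [smul_eq_iff]
  have : Real.exp circumradius * Real.exp (-(circumradius / 2)) =
      Real.exp (circumradius / 2) := by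
    rw [← Real.exp_add]; congr 1; ring
  apply Complex.ext
  · simp [topTranslation, topVertex, -Complex.ofReal_exp]
  · simpa [topTranslation, topVertex, -Complex.ofReal_exp] using this

theorem rotation_smul_I (θ : ℝ) : rotation θ • I = I := by
  rw [smul_eq_iff]
  apply Complex.ext <;> simp [rotation, -Complex.ofReal_sin, -Complex.ofReal_cos]

/-- The rotation about `topVertex` through the angle `θ`. -/
noncomputable def topRotation (θ : ℝ) : SL(2, ℝ) :=
  topTranslation * rotation θ * topTranslation⁻¹

theorem topRotation_smul (θ : ℝ) : topRotation θ • topVertex = topVertex := by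
  rw [topRotation, ← topTranslation_smul_I, smul_smul, inv_mul_cancel_right, mul_smul,
    rotation_smul_I]

theorem rotation_two_pi : rotation (2 * Real.pi) = -1 := by
  apply Subtype.ext
  ext i j
  fin_cases i <;> fin_cases j <;> simp [rotation]

/-- The definition of `circumradius` with denominators cleared; this is the only form in which the
size of the decagon enters below. -/
theorem circumradius_relation :
    Real.sin (Real.pi / 10) * Real.sin (Real.pi / 5) *
      (Real.exp circumradius + Real.exp (-circumradius)) =
    2 * Real.cos (Real.pi / 10) * Real.cos (Real.pi / 5) := by
  have hpi := Real.pi_pos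
  have hs : 0 < Real.sin (Real.pi / 10) :=
    Real.sin_pos_of_pos_of_lt_pi (by positivity) (by linarith)
  have hS : 0 < Real.sin (Real.pi / 5) :=
    Real.sin_pos_of_pos_of_lt_pi (by positivity) (by linarith)
  have h := Real.cosh_arcosh one_lt_cosh_circumradius.le
  rw [← circumradius, Real.cosh_eq, Real.cot_eq_cos_div_sin, Real.cot_eq_cos_div_sin] at h
  field_simp at h
  linarith

theorem sq_eq_neg_one_of_trace_eq_zero {g : SL(2, ℝ)} (h : g 0 0 + g 1 1 = 0) : g ^ 2 = -1 := by
  have hdet := det_eq_one g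
  have h' : g 1 1 = - g 0 0 := by linarith
  rw [h'] at hdet
  apply Subtype.ext
  rw [pow_two, Matrix.SpecialLinearGroup.coe_mul]
  ext i j
  fin_cases i <;> fin_cases j <;> simp [Matrix.mul_apply, Fin.sum_univ_two, h'] <;> linarith

/-- The rotation through `π` about the midpoint of a side. -/
theorem rotation_mul_topRotation_sq :
    (rotation (Real.pi / 5) * topRotation (2 * Real.pi / 5)) ^ 2 = -1 := by
  -- A matrix of determinant one squares to `-1` when its trace vanishes, and vanishing of this
  -- trace is exactly `circumradius_relation`.
  apply sq_eq_neg_one_of_trace_eq_zero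
  have h1 : Real.pi / 5 / 2 = Real.pi / 10 := by ring
  have h2 : 2 * Real.pi / 5 / 2 = Real.pi / 5 := by ring
  have h3 : Real.exp (circumradius / 2) * Real.exp (circumradius / 2) = Real.exp circumradius := by
    rw [← Real.exp_add]; congr 1; ring
  have h4 : Real.exp (-(circumradius / 2)) * Real.exp (-(circumradius / 2)) =
      Real.exp (-circumradius) := by
    rw [← Real.exp_add]; congr 1; ring
  have h5 : Real.exp (circumradius / 2) * Real.exp (-(circumradius / 2)) = 1 := by
    rw [← Real.exp_add]; simp
  have hR := circumradius_relation
  have e1 : (topRotation (2 * Real.pi / 5)).1 = !![Real.cos (Real.pi / 5),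
      Real.exp circumradius * Real.sin (Real.pi / 5);
      -(Real.exp (-circumradius) * Real.sin (Real.pi / 5)), Real.cos (Real.pi / 5)] := by
    rw [topRotation, Matrix.SpecialLinearGroup.coe_mul, Matrix.SpecialLinearGroup.coe_mul,
      Matrix.SpecialLinearGroup.coe_inv]
    simp only [topTranslation, rotation, h2, Matrix.adjugate_fin_two_of, Matrix.mul_fin_two,
      ← h3, ← h4]
    congr 1
    ext i j
    fin_cases i <;> fin_cases j <;> simp [-Real.cos_pi_div_five]
    · linear_combination Real.cos (Real.pi / 5) * h5
    · ring
    · ring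
    · linear_combination Real.cos (Real.pi / 5) * h5
  change (rotation (Real.pi / 5) * topRotation (2 * Real.pi / 5)).1 0 0 +
    (rotation (Real.pi / 5) * topRotation (2 * Real.pi / 5)).1 1 1 = 0
  rw [Matrix.SpecialLinearGroup.coe_mul, e1]
  simp only [rotation, h1, Matrix.mul_fin_two, Matrix.of_apply, Matrix.cons_val',
    Matrix.cons_val_zero, Matrix.cons_val_one, Matrix.cons_val_fin_one]
  linear_combination -hR
-- The triangle group relations
/-- The group of orientation preserving isometries of `ℍ`. -/
abbrev Motion : Type := (MulAction.toPermHom SL(2, ℝ) ℍ).range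

/-- The isometry given by a matrix. -/
noncomputable def toMotion : SL(2, ℝ) →* Motion := (MulAction.toPermHom SL(2, ℝ) ℍ).rangeRestrict

theorem toMotion_smul (g : SL(2, ℝ)) (z : ℍ) : toMotion g • z = g • z := rfl

theorem toMotion_surjective : Function.Surjective toMotion :=
  MonoidHom.rangeRestrict_surjective _

theorem Motion.ext {X Y : Motion} (h : ∀ z : ℍ, X • z = Y • z) : X = Y :=
  Subtype.ext (Equiv.ext h)

/-- Passing from matrices to isometries removes the sign, so that the relations between the
rotations hold exactly. -/
theorem toMotion_neg_one : toMotion (-1) = 1 :=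
  Motion.ext fun z => by rw [toMotion_smul, neg_one_smul_eq, one_smul]

theorem Motion.dist_smul (X : Motion) (z w : ℍ) : dist (X • z) (X • w) = dist z w := by
  obtain ⟨g, rfl⟩ := toMotion_surjective X
  exact _root_.dist_smul g z w

/-- The rotation of the decagon taking each vertex to the next one. -/
noncomputable def rho : Motion := toMotion (rotation (Real.pi / 5))

/-- The rotation about `topVertex` through `2π/5`. -/
noncomputable def sigma : Motion := toMotion (topRotation (2 * Real.pi / 5))

theorem rho_pow_ten : rho ^ 10 = 1 := by
  rw [rho, ← map_pow, rotation_pow, ← toMotion_neg_one, ← rotation_two_pi]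
  congr 2; push_cast; ring

theorem sigma_pow_five : sigma ^ 5 = 1 := by
  rw [sigma, ← map_pow, topRotation, conj_pow, rotation_pow,
    show ((5 : ℕ) : ℝ) * (2 * Real.pi / 5) = 2 * Real.pi by push_cast; ring, rotation_two_pi,
    ← toMotion_neg_one]
  congr 1; simp

theorem rho_mul_sigma_sq : (rho * sigma) ^ 2 = 1 := by
  rw [rho, sigma, ← map_mul, ← map_pow, rotation_mul_topRotation_sq, toMotion_neg_one]

theorem sigma_smul : sigma • topVertex = topVertex := topRotation_smul _

theorem decagonVertex_eq (k : ℕ) : decagonVertex k = rho ^ k • topVertex := by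
  rw [rho, ← map_pow, toMotion_smul, rotation_pow, decagonVertex]

/-- The hyperbolic cosine of the distance of `X • topVertex` to `q`. -/
noncomputable def height (q : ℍ) (X : Motion) : ℝ := Real.cosh (dist (X • topVertex) q)

/-! ### Golden-ratio relations between distances to a fixed point -/

theorem goldenRatio_eq_two_cos : goldenRatio = 2 * Real.cos (Real.pi / 5) := by
  rw [Real.cos_pi_div_five, goldenRatio]; ring

theorem cos_two_pi_div_five : 2 * Real.cos (2 * Real.pi / 5) = goldenRatio - 1 := by
  have h := goldenRatio_sq
  rw [show 2 * Real.pi / 5 = 2 * (Real.pi / 5) by ring, Real.cos_two_mul]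
  rw [goldenRatio_eq_two_cos] at *
  linarith

/-- Along the vertices of a decagon the height is a constant plus a sinusoid of step `π / 5`.
Differences placed symmetrically about the midpoint of a side have the ratio `sin (3π/10) / sin
(π/10) = φ ^ 2`, whatever `q` is. -/
theorem height_decagon (q : ℍ) (X : Motion) :
    height q (X * rho ^ 2) - height q (X * rho⁻¹) =
      goldenRatio ^ 2 * (height q (X * rho) - height q X) := by
  obtain ⟨g, rfl⟩ := toMotion_surjective X
  obtain ⟨B, E, h⟩ := cosh_dist_rotation topVertex (g⁻¹ • q)
  have key : ∀ θ, height q (toMotion g * toMotion (rotation θ)) =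
      Real.cosh (dist (rotation θ • topVertex) (g⁻¹ • q)) := by
    intro θ
    rw [height, mul_smul, toMotion_smul, toMotion_smul,
      ← _root_.dist_smul g (rotation θ • topVertex), smul_inv_smul]
  have h0 : height q (toMotion g) = Real.cosh (dist (rotation 0 • topVertex) (g⁻¹ • q)) := by
    rw [← key, rotation_zero, map_one, mul_one]
  rw [h0, rho, ← map_pow, ← map_inv, rotation_pow, rotation_inv, key, key, key, h, h, h, h]
  have h2 : ((2 : ℕ) : ℝ) * (Real.pi / 5) = 2 * (Real.pi / 5) := by norm_num
  rw [h2, Real.cos_neg, Real.sin_neg, Real.cos_two_mul, Real.sin_two_mul, Real.cos_zero,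
    Real.sin_zero]
  have hg := goldenRatio_sq
  have hg' := goldenRatio_eq_two_cos
  rw [hg]
  have hc : Real.cos (Real.pi / 5) = goldenRatio / 2 := by linarith
  rw [hc]
  ring

/-- The neighbours of a vertex lie on a circle about it at angles `2π / 5` apart. The sum of a
sinusoid at two symmetric angles is `2 cos (2π/5) = φ - 1` times its middle value, and its constant
term is the height of the centre times the hyperbolic cosine of the side length. -/
theorem height_star (q : ℍ) (X : Motion) :
    height q (X * sigma⁻¹ * rho) + height q (X * sigma * rho) =
      (goldenRatio - 1) * height q (X * rho) + (3 * goldenRatio + 1) * height q X := by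
  obtain ⟨g, rfl⟩ := toMotion_surjective X
  obtain ⟨D, hD⟩ : ∃ D, D = topTranslation := ⟨_, rfl⟩
  obtain ⟨B, E, h⟩ := cosh_dist_rotation ((D⁻¹ * rotation (Real.pi / 5)) • topVertex)
    ((g * D)⁻¹ • q)
  have key : ∀ θ, height q (toMotion g * toMotion (topRotation θ) * rho) =
      Real.cosh (dist (rotation θ • (D⁻¹ * rotation (Real.pi / 5)) • topVertex)
        ((g * D)⁻¹ • q)) := by
    intro θ
    rw [height, rho, ← map_mul, ← map_mul, toMotion_smul,
      ← _root_.dist_smul (g * D) (rotation θ • _), smul_inv_smul]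
    simp only [smul_smul, topRotation, ← hD]
    congr 3
    group
  have h0 : height q (toMotion g * rho) =
      height q (toMotion g * toMotion (topRotation 0) * rho) := by
    rw [topRotation, rotation_zero, mul_one, mul_inv_cancel, map_one, mul_one]
  have hinv : sigma⁻¹ = toMotion (topRotation (-(2 * Real.pi / 5))) := by
    rw [sigma, ← map_inv, topRotation, topRotation, ← rotation_inv]; congr 1; group
  rw [h0, hinv, sigma, key, key, key, h, h, h, Real.cos_neg, Real.sin_neg, Real.cos_zero,
    Real.sin_zero]
  have h1 : Real.cosh (dist ((g * D)⁻¹ • q) I) = height q (toMotion g) := by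
    rw [height, toMotion_smul, ← topTranslation_smul_I, ← _root_.dist_smul (g * D),
      smul_inv_smul, dist_comm, mul_smul, hD]
  -- The side length. The triangle spanned by the centre and a side has all angles `π / 5`, so the
  -- side is as long as the circumradius, whose hyperbolic cosine is `2φ + 1`.
  have h2 : Real.cosh (dist ((D⁻¹ * rotation (Real.pi / 5)) • topVertex) I) =
      2 * goldenRatio + 1 := by
    rw [mul_smul, ← _root_.dist_smul D, smul_inv_smul, hD, topTranslation_smul_I, cosh_dist_smul]
    have hR := circumradius_relation
    have hs : 0 < Real.sin (Real.pi / 10) :=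
      Real.sin_pos_of_pos_of_lt_pi (by positivity) (by linarith [Real.pi_pos])
    have hg' := goldenRatio_eq_two_cos
    have hg := goldenRatio_sq
    rw [show Real.pi / 5 = 2 * (Real.pi / 10) by ring, Real.sin_two_mul] at hR
    rw [show Real.pi / 5 = 2 * (Real.pi / 10) by ring] at hg'
    have hsc := Real.sin_sq_add_cos_sq (Real.pi / 10)
    have hc := Real.cos_two_mul (Real.pi / 10)
    have hcp : 0 < Real.cos (Real.pi / 10) :=
      Real.cos_pos_of_mem_Ioo ⟨by linarith [Real.pi_pos], by linarith [Real.pi_pos]⟩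
    have he : 0 < Real.exp circumradius := Real.exp_pos _
    have htr : topVertex.re = 0 := rfl
    have hti : topVertex.im = Real.exp circumradius := rfl
    rw [htr, hti]
    simp only [rotation, Matrix.SpecialLinearGroup.coe_mk, Matrix.of_apply, Matrix.cons_val',
      Matrix.cons_val_zero, Matrix.cons_val_one, Matrix.cons_val_fin_one,
      show Real.pi / 5 / 2 = Real.pi / 10 by ring]
    rw [Real.exp_neg] at hR
    rw [hc] at hR
    generalize Real.exp circumradius = y at *
    generalize Real.cos (Real.pi / 10) = c at *
    generalize Real.sin (Real.pi / 10) = s at *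
    rw [hc] at hg'
    field_simp at hR
    have hc2 : c ^ 2 = (goldenRatio + 2) / 4 := by linarith
    have hs2 : s ^ 2 = (2 - goldenRatio) / 4 := by linarith
    have hR2 : y ^ 2 + 1 = y * (4 * goldenRatio + 2) := by
      have hR' : (2 - goldenRatio) / 4 * (y ^ 2 + 1) = y * (goldenRatio / 2) := by
        rw [← hs2]; linear_combination hR - y / 2 * hg'
      generalize goldenRatio = φ at *
      linear_combination 4 * (φ + 1) * hR' + (y ^ 2 + 1) * hg + 2 * y * hg
    have h4 : y ^ 4 + 1 = y ^ 2 * (32 * goldenRatio + 18) := by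
      generalize goldenRatio = φ at *
      linear_combination (y ^ 2 + 1 + y * (4 * φ + 2)) * hR2 + 16 * y ^ 2 * hg
    rw [div_eq_iff (by positivity)]
    generalize goldenRatio = φ at *
    linear_combination s ^ 2 * h4 + (y ^ 2 * (32 * φ + 18)) * hs2 + 2 * y ^ 2 * hc2 -
      8 * y ^ 2 * hg
  rw [h1, h2]
  have h3 := cos_two_pi_div_five
  have hg := goldenRatio_sq
  linear_combination B * h3 - height q (toMotion g) * 2 * hg

/-! ### Steps of the tiling as isometries

The letters are numbered cyclically in the order `a b c d e ā b̄ c̄ d̄ ē` in which they occur around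
the decagon, so that `m + 5` is the inverse of `m`.  The even letters leave one kind of vertices,
the odd ones the other kind. -/

/-- The isometry moving the neighbourhood of `topVertex` along the side with the given letter. -/
noncomputable def step (m : ZMod 10) : Motion :=
  sigma ^ (-(m.val : ℤ)) * rho * sigma ^ ((m.val : ℤ) + 1)

theorem sigma_zpow_five_mul (n : ℤ) : sigma ^ (5 * n) = 1 := by
  rw [zpow_mul, show (5 : ℤ) = ((5 : ℕ) : ℤ) from rfl, zpow_natCast, sigma_pow_five, one_zpow]

theorem step_intCast (n : ℤ) : step (n : ZMod 10) = sigma ^ (-n) * rho * sigma ^ (n + 1) := by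
  -- The multiple of 10 is written as a multiple of 5, the order of `sigma`.
  have h : (((n : ZMod 10).val : ℕ) : ℤ) = n + 5 * (-2 * (n / 10)) := by
    rw [ZMod.val_intCast]; push_cast; lia
  rw [step, h, show -(n + 5 * (-2 * (n / 10))) = -n + 5 * (2 * (n / 10)) by ring,
    show n + 5 * (-2 * (n / 10)) + 1 = n + 1 + 5 * (-2 * (n / 10)) by ring, zpow_add,
    zpow_add _ (n + 1), sigma_zpow_five_mul, sigma_zpow_five_mul, mul_one, mul_one]

theorem sigma_zpow_smul (n : ℤ) : sigma ^ n • topVertex = topVertex := by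
  have h : sigma ∈ MulAction.stabilizer Motion topVertex := sigma_smul
  exact Subgroup.zpow_mem _ h n

theorem sigma_rho_sigma : sigma * rho * sigma = rho⁻¹ := by
  have h := rho_mul_sigma_sq
  rw [pow_two] at h
  rw [eq_inv_iff_mul_eq_one, ← mul_right_inj rho, mul_one]
  calc rho * (sigma * rho * sigma * rho) = (rho * sigma * (rho * sigma)) * rho := by group
    _ = rho := by rw [h, one_mul]

/-- The powers of `sigma` telescope: consecutive letters walk counter-clockwise around one decagon.
-/
theorem step_run_intCast (n : ℤ) (k : ℕ) :
    ((List.range k).map fun i : ℕ => step ((n : ZMod 10) + i)).prod =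
      sigma ^ (-n) * rho ^ k * sigma ^ (n + k) := by
  induction k with
  | zero => simp
  | succ k ih =>
    rw [List.range_succ, List.map_append, List.prod_append, ih, List.map_singleton,
      List.prod_singleton, show ((n : ZMod 10) + (k : ZMod 10)) = ((n + k : ℤ) : ZMod 10) by
        push_cast; rfl, step_intCast, pow_succ]
    push_cast
    group

theorem step_mul_step_add_five (m : ZMod 10) : step m * step (m + 5) = 1 := by
  obtain ⟨n, rfl⟩ := ZMod.intCast_surjective m
  rw [show ((n : ZMod 10) + 5) = ((n + 5 : ℤ) : ZMod 10) by push_cast; rfl, step_intCast,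
    step_intCast]
  have h5 : sigma ^ (-(n + 5)) = sigma ^ (-n) := by
    rw [show -(n + 5) = -n + 5 * (-1) by ring, zpow_add, sigma_zpow_five_mul, mul_one]
  have h5' : sigma ^ (n + 5 + 1) = sigma * sigma ^ n := by
    rw [show n + 5 + 1 = 5 * 1 + (1 + n) by ring, zpow_add, sigma_zpow_five_mul, one_mul, zpow_add,
      zpow_one]
  rw [h5, h5']
  calc sigma ^ (-n) * rho * sigma ^ (n + 1) * (sigma ^ (-n) * rho * (sigma * sigma ^ n))
      = sigma ^ (-n) * (rho * (sigma * rho * sigma)) * sigma ^ n := by group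
    _ = 1 := by rw [sigma_rho_sigma]; group

theorem step_add_five (m : ZMod 10) : step (m + 5) = (step m)⁻¹ :=
  (inv_eq_of_mul_eq_one_right (step_mul_step_add_five m)).symm

/-- The two ways around a decagon from a vertex to the opposite one agree. -/
theorem step_half_decagon (m : ZMod 10) :
    step m * step (m + 1) * step (m + 2) * step (m + 3) * step (m + 4) =
      step (m + 4) * step (m + 3) * step (m + 2) * step (m + 1) * step m := by
  have key : ∀ n : ℤ, step (n : ZMod 10) * step (n + 1) * step (n + 2) * step (n + 3) *
      step (n + 4) = sigma ^ (-n) * rho ^ 5 * sigma ^ n := by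
    intro n
    have h := step_run_intCast n 5
    simp only [List.range_succ, List.range_zero, List.map_append, List.map_nil, List.map_cons,
      List.prod_append, List.prod_cons, List.prod_nil, List.nil_append, mul_one,
      Nat.cast_zero, add_zero, Nat.cast_one, Nat.cast_ofNat] at h
    rw [h, zpow_add, ← mul_one (5 : ℤ), sigma_zpow_five_mul, mul_one]
  obtain ⟨n, rfl⟩ := ZMod.intCast_surjective m
  -- The descending half circuit is the inverse of the ascending one that starts at `n + 5`. Both
  -- equal the same conjugate of `rho ^ 5`, which is an involution.
  have h2 := key (n + 5)
  have hz : sigma ^ (-(n + 5)) = sigma ^ (-n) := by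
    rw [show -(n + 5) = -n + 5 * (-1) by ring, zpow_add, sigma_zpow_five_mul, mul_one]
  have hz' : sigma ^ (n + 5) = sigma ^ n := by
    rw [show n + 5 = n + 5 * 1 by ring, zpow_add, sigma_zpow_five_mul, mul_one]
  rw [hz, hz', Int.cast_add, Int.cast_ofNat] at h2
  simp only [add_right_comm (n : ZMod 10) 5] at h2
  simp only [step_add_five] at h2
  have h3 := congrArg (fun x => x⁻¹) h2
  simp only [mul_inv_rev, inv_inv] at h3
  rw [key]
  simp only [mul_assoc] at h3 ⊢
  rw [h3]
  have : (rho ^ 5)⁻¹ = rho ^ 5 := by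
    rw [inv_eq_iff_mul_eq_one, ← pow_add, rho_pow_ten]
  rw [this]
  group

/-! ### Height relations -/

theorem height_pos (q : ℍ) (X : Motion) : 0 < height q X := Real.cosh_pos _

theorem height_mul_sigma_zpow (q : ℍ) (X : Motion) (n : ℤ) :
    height q (X * sigma ^ n) = height q X := by
  rw [height, mul_smul, sigma_zpow_smul, height]

theorem height_mul_step (q : ℍ) (X : Motion) (n : ℤ) :
    height q (X * step (n : ZMod 10)) = height q (X * sigma ^ (-n) * rho) := by
  rw [step_intCast, ← mul_assoc, height_mul_sigma_zpow, mul_assoc X]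

theorem height_star_step (q : ℍ) (X : Motion) (m : ZMod 10) :
    height q (X * step (m - 4)) + height q (X * step (m + 4)) =
      (goldenRatio - 1) * height q (X * step m) + (3 * goldenRatio + 1) * height q X := by
  obtain ⟨n, rfl⟩ := ZMod.intCast_surjective m
  have h := height_star q (X * sigma ^ (-n))
  rw [height_mul_sigma_zpow] at h
  rw [show ((n : ZMod 10) - 4) = ((n - 4 : ℤ) : ZMod 10) by push_cast; rfl,
    show ((n : ZMod 10) + 4) = ((n + 4 : ℤ) : ZMod 10) by push_cast; rfl, height_mul_step,
    height_mul_step, height_mul_step, ← h]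
  have h1 : sigma ^ (-(n - 4)) = sigma ^ (-n) * sigma⁻¹ := by
    rw [show -(n - 4) = -n + -1 + 5 * 1 by ring, zpow_add, sigma_zpow_five_mul, zpow_add]
    simp
  have h2 : sigma ^ (-(n + 4)) = sigma ^ (-n) * sigma := by
    rw [show -(n + 4) = -n + 1 + 5 * (-1) by ring, zpow_add, sigma_zpow_five_mul, zpow_add]
    simp
  rw [h1, h2]
  simp only [mul_assoc]

/-- The previous vertex of the decagon is also the next neighbour around `topVertex`; this links the
decagon relation to the star relation. -/
theorem rho_inv_smul : rho⁻¹ • topVertex = (sigma * rho) • topVertex := by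
  rw [← sigma_rho_sigma, mul_smul, sigma_smul]

/-- Four consecutive vertices of a decagon, traversed counter-clockwise. -/
theorem height_decagon_step (q : ℍ) (X : Motion) (m : ZMod 10) :
    height q (X * step m * step (m + 1)) - height q (X * step (m + 4)) =
      goldenRatio ^ 2 * (height q (X * step m) - height q X) := by
  obtain ⟨n, rfl⟩ := ZMod.intCast_surjective m
  have h := height_decagon q (X * sigma ^ (-n))
  rw [height_mul_sigma_zpow] at h
  rw [show ((n : ZMod 10) + 4) = ((n + 4 : ℤ) : ZMod 10) by push_cast; rfl, height_mul_step,
    height_mul_step, ← h]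
  have h1 := step_run_intCast n 2
  simp only [List.range_succ, List.range_zero, List.map_append, List.map_nil, List.map_cons,
    List.prod_append, List.prod_cons, List.prod_nil, List.nil_append, mul_one,
    Nat.cast_zero, add_zero, Nat.cast_one, Nat.cast_ofNat] at h1
  have h2 : sigma ^ (-(n + 4)) = sigma ^ (-n) * sigma := by
    rw [show -(n + 4) = -n + 1 + 5 * (-1) by ring, zpow_add, sigma_zpow_five_mul, zpow_add]
    simp
  congr 1
  · rw [mul_assoc X, h1, ← mul_assoc, height_mul_sigma_zpow, mul_assoc X]
  · rw [h2, height, height, mul_smul _ rho⁻¹, rho_inv_smul, smul_smul]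
    simp only [mul_assoc]

/-- Four consecutive vertices of a decagon, traversed clockwise. -/
theorem height_decagon_step_neg (q : ℍ) (X : Motion) (m : ZMod 10) :
    height q (X * step m * step (m - 1)) - height q (X * step (m - 4)) =
      goldenRatio ^ 2 * (height q (X * step m) - height q X) := by
  -- The same four vertices, read from the other end of the side `m`.
  have h := height_decagon_step q (X * step m) (m + 5)
  have e1 : ∀ m : ZMod 10, m + 5 + 1 = m - 4 := by decide
  have e2 : ∀ m : ZMod 10, m + 5 + 4 = m - 1 := by decide
  rw [e1, e2, mul_assoc X, step_mul_step_add_five, mul_one] at h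
  linarith

theorem height_decagon_sign (q : ℍ) (X : Motion) (m s : ZMod 10) (hs : s = 1 ∨ s = -1) :
    height q (X * step m * step (m - s)) - height q (X * step (m - 4 * s)) =
      goldenRatio ^ 2 * (height q (X * step m) - height q X) := by
  rcases hs with rfl | rfl
  · rw [mul_one]; exact height_decagon_step_neg q X m
  · rw [sub_neg_eq_add, mul_neg_one, sub_neg_eq_add]; exact height_decagon_step q X m

/-! ### Admissible words -/

/-- The parity of a letter. -/
def parity (m : ZMod 10) : Bool := m.val % 2 == 1

/-- `1` for even and `-1` for odd letters. -/
def sgn (m : ZMod 10) : ZMod 10 := if parity m then -1 else 1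

theorem sgn_eq (m : ZMod 10) : sgn m = 1 ∨ sgn m = -1 := by
  unfold sgn; split <;> simp

/-- Words which can be read from a vertex of the given parity. -/
def Typed : Bool → List (ZMod 10) → Prop
  | _, [] => True
  | b, m :: w => parity m = b ∧ Typed (!b) w

/-- Freely reduced words without bad turns. -/
def Admissible : List (ZMod 10) → Prop
  | [] => True
  | m :: w => w.head? ≠ some (m + 5) ∧
      ¬ [m - sgn m, m - 2 * sgn m, m - 3 * sgn m, m - 4 * sgn m] <+: w ∧ Admissible w

/-- The isometry given by a word. -/
noncomputable def eval (w : List (ZMod 10)) : Motion := (w.map step).prod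

theorem eval_cons (m : ZMod 10) (w : List (ZMod 10)) : eval (m :: w) = step m * eval w := by
  simp [eval]

theorem eval_nil : eval [] = 1 := rfl

/-! ### The cone of a letter at a vertex -/

/-- The point `q` is in the cone of the letter `m` at the vertex `X • topVertex`: the region
bounded by rays of the perpendicular bisectors of the side with letter `m` and of one of its two
neighbours. -/
def Cone (q : ℍ) (X : Motion) (m : ZMod 10) : Prop :=
  height q (X * step m) < height q X ∧ height q X < height q (X * step (m - 4 * sgn m))

/-- The point `q` is on the far side of the decagon at `X • topVertex` whose two sides there have
the letters `m` and `m - 4 * sgn m`. -/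
def Beyond (q : ℍ) (X : Motion) (m : ZMod 10) : Prop :=
  height q X < height q (X * step m) ∧
    0 < height q (X * step m) - height q X +
      goldenRatio * (height q (X * step (m - 4 * sgn m)) - height q X)

theorem height_star_sgn (q : ℍ) (X : Motion) (m t : ZMod 10) (ht : t = 1 ∨ t = -1) :
    height q (X * step (m - 4 * t)) + height q (X * step (m + 4 * t)) =
      (goldenRatio - 1) * height q (X * step m) + (3 * goldenRatio + 1) * height q X := by
  rw [← height_star_step]
  rcases ht with rfl | rfl
  · simp
  · simp only [mul_neg, mul_one, sub_neg_eq_add, ← sub_eq_add_neg]; ring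

/-- Cones of adjacent edges lie on opposite sides of a common bisector. For edges two apart, both
end points would be nearer to `q` than the centre, while the star relation at the edge between makes
their heights add up to more than `3φ + 1` times that of the centre. -/
theorem Cone.eq {q : ℍ} {X : Motion} {m m' : ZMod 10} (h : Cone q X m) (h' : Cone q X m')
    (hp : parity m = parity m') : m = m' := by
  have cases : ∀ m m' : ZMod 10, parity m = parity m' → sgn m' = sgn m ∧ (m = m' ∨
      m = m' - 4 * sgn m' ∨ m' = m - 4 * sgn m ∨
      (m + 4 * sgn m) + 4 * sgn m = m' ∨ (m' + 4 * sgn m') + 4 * sgn m' = m) := by decide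
  have hg := one_lt_goldenRatio
  have far : ∀ m m' : ZMod 10, (m + 4 * sgn m) + 4 * sgn m = m' → Cone q X m → Cone q X m' →
      False := by
    rintro m m' rfl ⟨h1, -⟩ ⟨h2, -⟩
    have h3 := height_star_sgn q X (m + 4 * sgn m) (sgn m) (sgn_eq m)
    rw [add_sub_cancel_right] at h3
    have h4 := mul_pos (sub_pos.2 hg) (height_pos q (X * step (m + 4 * sgn m)))
    nlinarith [height_pos q X]
  obtain ⟨-, rfl | e | e | e | e⟩ := cases m m' hp
  · rfl
  · exact absurd (e ▸ h'.2) h.1.not_gt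
  · exact absurd (e ▸ h.2) h'.1.not_gt
  · exact (far _ _ e h h').elim
  · exact (far _ _ e h' h).elim

/-- The star relations force the neighbours along the decagon to be far from `q` when `q` is in one
of the other three cones. In the cone next to `m - 4 * sgn m`, that neighbour may itself be nearer
than the centre; this is why the second condition in `Beyond` is a weighted sum. -/
theorem Cone.beyond {q : ℍ} {X : Motion} {e m : ZMod 10} (h : Cone q X e)
    (hp : parity e = parity m) (h1 : e ≠ m) (h2 : e ≠ m - 4 * sgn m) : Beyond q X m := by
  have cases : ∀ e m : ZMod 10, parity e = parity m → sgn e = sgn m ∧ (e = m ∨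
      e = m - 4 * sgn m ∨ e = m + 4 * sgn m ∨ e = m + 4 * sgn m + 4 * sgn m ∨
      e = m - 4 * sgn m - 4 * sgn m) := by decide
  have hg := one_lt_goldenRatio
  obtain ⟨hc1, hc2⟩ := h
  have hX := height_pos q X
  have hs := sgn_eq m
  obtain ⟨he, rfl | rfl | rfl | rfl | rfl⟩ := cases e m hp
  · exact absurd rfl h1
  · exact absurd rfl h2
  · rw [he, add_sub_cancel_right] at hc2
    have r := height_star_sgn q X m (sgn m) hs
    have p := mul_pos (sub_pos.2 hg) (height_pos q (X * step m))
    have h3 : height q X < height q (X * step (m - 4 * sgn m)) := by nlinarith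
    exact ⟨hc2, by nlinarith⟩
  · rw [he, add_sub_cancel_right] at hc2
    have r1 := height_star_sgn q X (m + 4 * sgn m) (sgn m) hs
    have r2 := height_star_sgn q X (m - 4 * sgn m - 4 * sgn m) (sgn m) hs
    rw [add_sub_cancel_right] at r1
    have far : ∀ m : ZMod 10,
        m - 4 * sgn m - 4 * sgn m - 4 * sgn m = m + 4 * sgn m + 4 * sgn m := by decide
    rw [sub_add_cancel, far] at r2
    have p1 := mul_pos (sub_pos.2 hg) (height_pos q (X * step (m + 4 * sgn m)))
    have p2 := mul_pos (sub_pos.2 hg) (height_pos q (X * step (m - 4 * sgn m - 4 * sgn m)))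
    have h3 : height q X < height q (X * step (m - 4 * sgn m)) := by nlinarith
    have h4 : height q X < height q (X * step m) := by nlinarith
    exact ⟨h4, by nlinarith⟩
  · have r := height_star_sgn q X (m - 4 * sgn m) (sgn m) hs
    rw [sub_add_cancel] at r
    have p := mul_pos (sub_pos.2 hg) (height_pos q (X * step (m - 4 * sgn m)))
    have p' := mul_pos (sub_pos.2 hg) hX
    have p'' := mul_pos (one_pos.trans hg) (height_pos q (X * step (m - 4 * sgn m)))
    exact ⟨by nlinarith, by nlinarith⟩

theorem beyond_self (X : Motion) (m : ZMod 10) : Beyond (X • topVertex) X m := by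
  have h0 : height (X • topVertex) X = 1 := by simp [height]
  have h1 : ∀ m, height (X • topVertex) (X * step m) =
      Real.cosh (dist (rho • topVertex) topVertex) := by
    intro m
    obtain ⟨n, rfl⟩ := ZMod.intCast_surjective m
    rw [height_mul_step, height, mul_assoc, mul_smul, Motion.dist_smul, mul_smul]
    conv_lhs => rw [← sigma_zpow_smul (-n)]
    rw [Motion.dist_smul, sigma_zpow_smul]
  have h2 := height_star_step (X • topVertex) X m
  have hg := one_lt_goldenRatio
  have hg' := Real.goldenRatio_lt_two
  simp only [h0, h1] at h2
  have h3 : 1 < Real.cosh (dist (rho • topVertex) topVertex) := by nlinarith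
  simp only [Beyond, h0, h1]
  exact ⟨h3, by nlinarith⟩

/-- The situation where a path leaves a decagon or stops on it: the next letter, if any, is neither
of the two sides of the decagon at that vertex. -/
theorem beyond_of_tail {q : ℍ} {X : Motion} {m : ZMod 10} {w : List (ZMod 10)}
    (hq : q = (X * eval w) • topVertex) (hw : Typed (parity m) w)
    (hcone : ∀ e v, w = e :: v → Cone q X e) (h1 : w.head? ≠ some m)
    (h2 : w.head? ≠ some (m - 4 * sgn m)) : Beyond q X m := by
  cases w with
  | nil => rw [hq, eval_nil, mul_one]; exact beyond_self X m
  | cons e v =>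
    exact (hcone e v rfl).beyond hw.1 (fun h => h1 (by simp [h])) (fun h => h2 (by simp [h]))

/-- This and the next three are the linear algebra of transport along a decagon. Here `xᵢ` is the
height of its `i`-th vertex, `x₉` preceding `x₀`; the hypotheses say that `q` is beyond the decagon
at vertex 1, 2, 3 or 4, and the conclusion is the cone condition at vertex 0. -/
theorem sector_of_beyond_one {φ x₀ x₁ x₂ x₉ : ℝ} (hφ : 1 < φ) (hφ2 : φ ^ 2 = φ + 1)
    (d0 : x₂ - x₉ = φ ^ 2 * (x₁ - x₀)) (h1 : x₁ < x₀) (h2 : 0 < x₀ - x₁ + φ * (x₂ - x₁)) :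
    x₁ < x₀ ∧ x₀ < x₉ := by
  refine ⟨h1, ?_⟩
  rw [hφ2] at d0
  have e : φ * (x₉ - x₀) = (x₀ - x₁ + φ * (x₂ - x₁)) + φ * (x₀ - x₁) := by
    linear_combination (x₀ - x₁) * hφ2 - φ * d0
  have := mul_pos (one_pos.trans hφ) (sub_pos.2 h1)
  have : 0 < φ * (x₉ - x₀) := by linarith
  linarith [pos_of_mul_pos_right this (one_pos.trans hφ).le]

theorem sector_of_beyond_two {φ x₀ x₁ x₂ x₃ x₉ : ℝ} (hφ : 1 < φ) (hφ2 : φ ^ 2 = φ + 1)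
    (d0 : x₂ - x₉ = φ ^ 2 * (x₁ - x₀)) (d1 : x₃ - x₀ = φ ^ 2 * (x₂ - x₁))
    (h1 : x₂ < x₃) (h2 : 0 < x₃ - x₂ + φ * (x₁ - x₂)) : x₁ < x₀ ∧ x₀ < x₉ := by
  rw [hφ2] at d0 d1
  have e : x₀ - x₁ = x₃ - x₂ + φ * (x₁ - x₂) := by linear_combination -d1
  have e' : x₉ - x₀ = (φ - 1) * (x₃ - x₂) + (x₀ - x₁) := by
    linear_combination -d0 - (φ - 1) * d1 - (x₂ - x₁) * hφ2
  have := mul_pos (sub_pos.2 hφ) (sub_pos.2 h1)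
  constructor <;> linarith

theorem sector_of_beyond_three {φ x₀ x₁ x₂ x₃ x₄ x₉ : ℝ} (hφ : 1 < φ) (hφ2 : φ ^ 2 = φ + 1)
    (d0 : x₂ - x₉ = φ ^ 2 * (x₁ - x₀)) (d1 : x₃ - x₀ = φ ^ 2 * (x₂ - x₁))
    (d2 : x₄ - x₁ = φ ^ 2 * (x₃ - x₂)) (h1 : x₃ < x₂) (h2 : 0 < x₂ - x₃ + φ * (x₄ - x₃)) :
    x₁ < x₀ ∧ x₀ < x₉ := by
  rw [hφ2] at d0 d1 d2
  have e : x₀ - x₁ = (x₂ - x₃ + φ * (x₄ - x₃)) + (φ - 1) * (x₂ - x₃) := by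
    linear_combination -d1 - φ * d2 - (x₃ - x₂) * hφ2
  have e' : x₉ - x₀ = x₂ - x₃ + φ * (x₄ - x₃) := by
    linear_combination -d0 - φ * d1 - φ * d2 - (x₃ - x₁) * hφ2
  have := mul_pos (sub_pos.2 hφ) (sub_pos.2 h1)
  constructor <;> linarith

theorem sector_of_beyond_four {φ x₀ x₁ x₂ x₃ x₄ x₅ x₉ : ℝ} (hφ : 1 < φ) (hφ2 : φ ^ 2 = φ + 1)
    (d0 : x₂ - x₉ = φ ^ 2 * (x₁ - x₀)) (d1 : x₃ - x₀ = φ ^ 2 * (x₂ - x₁))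
    (d2 : x₄ - x₁ = φ ^ 2 * (x₃ - x₂)) (d3 : x₅ - x₂ = φ ^ 2 * (x₄ - x₃))
    (h1 : x₄ < x₅) (h2 : 0 < x₅ - x₄ + φ * (x₃ - x₄)) : x₁ < x₀ ∧ x₀ < x₉ := by
  -- Under `d3` the two inequalities at vertex 4 become those at vertex 3 in the opposite order.
  refine sector_of_beyond_three hφ hφ2 d0 d1 d2 ?_ ?_ <;> rw [hφ2] at d3 <;> linarith

/-- The vertices reached by an admissible word lie in the cone of its first letter. -/
theorem Admissible.cone {m : ZMod 10} {w : List (ZMod 10)} (h : Admissible (m :: w))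
    (hw : Typed (!parity m) w) (X : Motion) :
    Cone ((X * step m * eval w) • topVertex) X m := by
  obtain ⟨n, hn⟩ : ∃ n, w.length ≤ n := ⟨_, le_rfl⟩
  induction n using Nat.strong_induction_on generalizing m w X with
  | _ n ih =>
  have ih' : ∀ v : List (ZMod 10), v.length ≤ n → Admissible v → ∀ b, Typed b v → ∀ Y : Motion,
      ∀ e u, v = e :: u → Cone ((Y * eval v) • topVertex) Y e := by
    rintro v hv hA b hT Y e u rfl
    rw [eval_cons, ← mul_assoc]
    refine ih u.length (by simpa using hv) hA ?_ Y le_rfl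
    rw [hT.1]; exact hT.2
  have letters : ∀ m : ZMod 10, m + 5 - 4 * sgn (m + 5) = m - sgn m ∧
      m - 2 * sgn m - 4 * sgn (m - 2 * sgn m) = m - sgn m + 5 ∧
      m - 2 * sgn m + 5 - 4 * sgn (m - 2 * sgn m + 5) = m - 3 * sgn m ∧
      m - 4 * sgn m - 4 * sgn (m - 4 * sgn m) = m - 3 * sgn m + 5 ∧
      m - sgn m - 4 * sgn m = m + 5 ∧ m - 2 * sgn m - 4 * sgn m = m - sgn m + 5 ∧
      m - 3 * sgn m - 4 * sgn m = m - 2 * sgn m + 5 := by decide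
  have parities : ∀ m : ZMod 10, parity (m + 5) = !parity m ∧
      parity (m - 2 * sgn m) = parity m ∧ parity (m - 2 * sgn m + 5) = !parity m ∧
      parity (m - 4 * sgn m) = parity m := by decide
  have minus : ∀ m s : ZMod 10, m - s - s = m - 2 * s ∧ m - 2 * s - s = m - 3 * s ∧
      m - 3 * s - s = m - 4 * s := fun m s => ⟨by ring, by ring, by ring⟩
  obtain ⟨l1, l2, l3, l4, l5, l6, l7⟩ := letters m
  obtain ⟨p1, p2, p3, p4⟩ := parities m
  obtain ⟨s1, s2, s3⟩ := minus m (sgn m)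
  have hs := sgn_eq m
  have back : ∀ (Y : Motion) (e : ZMod 10), Y * step e * step (e + 5) = Y := fun Y e => by
    rw [mul_assoc, step_mul_step_add_five, mul_one]
  obtain ⟨q, hq⟩ : ∃ q, q = (X * step m * eval w) • topVertex := ⟨_, rfl⟩
  rw [← hq]
  set s := sgn m with hsdef
  have hg := one_lt_goldenRatio
  have hg2 := goldenRatio_sq
  -- The decagon in question has the sides `m` and `m - 4 * s` at the starting vertex, and
  -- continuing around it reads `m, m - s, m - 2 * s, …`. These are the relations for its successive
  -- quadruples of vertices.
  have d0 := height_decagon_sign q X m s hs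
  have d1 := height_decagon_sign q (X * step m) (m - s) s hs
  have d2 := height_decagon_sign q (X * step m * step (m - s)) (m - 2 * s) s hs
  have d3 := height_decagon_sign q (X * step m * step (m - s) * step (m - 2 * s)) (m - 3 * s) s hs
  rw [l5, back, s1] at d1
  rw [l6, back, s2] at d2
  rw [l7, back, s3] at d3
  by_cases c1 : w.head? = some (m - s)
  swap
  -- The path leaves after one edge. The distinguished side in `Beyond` depends on parity: it is the
  -- side just traversed at the first and third vertices, and the side ahead at the second and
  -- fourth. The other side is excluded by free reduction or by the case assumption accordingly.
  · have hb := beyond_of_tail (m := m + 5) hq (p1 ▸ hw)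
      (fun e v hv => hq ▸ ih' w hn h.2.2 _ hw _ e v hv) h.1 (by rwa [l1])
    rw [Beyond, l1, back] at hb
    exact sector_of_beyond_one hg hg2 d0 hb.1 hb.2
  obtain ⟨w, rfl⟩ : ∃ v, w = (m - s) :: v := by cases w <;> simp_all
  obtain ⟨-, hb1, h1⟩ := h
  have hw1 := hw.2
  rw [Bool.not_not] at hw1
  rw [eval_cons, ← mul_assoc] at hq
  rw [List.length_cons] at hn
  by_cases c2 : w.head? = some (m - 2 * s)
  swap
  · have hb := beyond_of_tail (m := m - 2 * s) hq (by rwa [p2])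
      (fun e v hv => hq ▸ ih' w (by lia) h1.2.2 _ hw1 _ e v hv) c2 (by rw [l2]; exact h1.1)
    rw [Beyond, l2, back] at hb
    exact sector_of_beyond_two hg hg2 d0 d1 hb.1 hb.2
  obtain ⟨w, rfl⟩ : ∃ v, w = (m - 2 * s) :: v := by cases w <;> simp_all
  obtain ⟨-, -, h2⟩ := h1
  have hw2 := hw1.2
  rw [eval_cons, ← mul_assoc] at hq
  rw [List.length_cons] at hn
  by_cases c3 : w.head? = some (m - 3 * s)
  swap
  · have hb := beyond_of_tail (m := m - 2 * s + 5) hq (by rwa [p3])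
      (fun e v hv => hq ▸ ih' w (by lia) h2.2.2 _ hw2 _ e v hv) h2.1 (by rwa [l3])
    rw [Beyond, l3, back] at hb
    exact sector_of_beyond_three hg hg2 d0 d1 d2 hb.1 hb.2
  obtain ⟨w, rfl⟩ : ∃ v, w = (m - 3 * s) :: v := by cases w <;> simp_all
  obtain ⟨-, -, h3⟩ := h2
  have hw3 := hw2.2
  rw [Bool.not_not] at hw3
  rw [eval_cons, ← mul_assoc] at hq
  rw [List.length_cons] at hn
  -- A fifth edge around the decagon would complete a bad turn; this is the only place where their
  -- absence is needed.
  have c4 : w.head? ≠ some (m - 4 * s) := by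
    intro c4
    obtain ⟨w, rfl⟩ : ∃ v, w = (m - 4 * s) :: v := by cases w <;> simp_all
    exact hb1 ⟨w, rfl⟩
  have hb := beyond_of_tail (m := m - 4 * s) hq (by rwa [p4])
    (fun e v hv => hq ▸ ih' w (by lia) h3.2.2 _ hw3 _ e v hv) c4 (by rw [l4]; exact h3.1)
  rw [Beyond, l4, back] at hb
  exact sector_of_beyond_four hg hg2 d0 d1 d2 d3 hb.1 hb.2

/-- Admissible words are determined by the vertex they lead to. -/
theorem Admissible.eq_of_smul_eq {b : Bool} {v w : List (ZMod 10)} (hv : Admissible v)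
    (hw : Admissible w) (tv : Typed b v) (tw : Typed b w)
    (h : eval v • topVertex = eval w • topVertex) : v = w := by
  have ne_nil : ∀ (b : Bool) (m : ZMod 10) (v : List (ZMod 10)), Admissible (m :: v) →
      Typed b (m :: v) → eval (m :: v) • topVertex ≠ topVertex := by
    intro b m v hv tv h
    have hc := hv.cone (by rw [tv.1]; exact tv.2) 1
    rw [one_mul, ← eval_cons, h] at hc
    have := (beyond_self 1 m).1
    rw [one_smul] at this
    exact lt_asymm hc.1 this
  induction v generalizing w b with
  | nil =>
    cases w with
    | nil => rfl
    | cons e w => exact (ne_nil b e w hw tw (by rw [← h, eval_nil, one_smul])).elim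
  | cons m v ih =>
    cases w with
    | nil => exact (ne_nil b m v hv tv (by rw [h, eval_nil, one_smul])).elim
    | cons e w =>
      have hc := hv.cone (by rw [tv.1]; exact tv.2) 1
      have hc' := hw.cone (by rw [tw.1]; exact tw.2) 1
      rw [one_mul, ← eval_cons] at hc hc'
      rw [← h] at hc'
      obtain rfl := hc.eq hc' (tv.1.trans tw.1.symm)
      rw [eval_cons, eval_cons, mul_smul, mul_smul, smul_left_cancel_iff] at h
      rw [ih hv.2.2 hw.2.2 tv.2 tw.2 h]

/-! ### Reduction to admissible words -/

theorem eval_bad_turn (l : ZMod 10) (w : List (ZMod 10)) :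
    eval (l :: (l - sgn l) :: (l - 2 * sgn l) :: (l - 3 * sgn l) :: (l - 4 * sgn l) :: w) =
      eval ((l - 4 * sgn l) :: (l - 3 * sgn l) :: (l - 2 * sgn l) :: (l - sgn l) :: l :: w) := by
  simp only [eval_cons, ← mul_assoc]
  congr 1
  rcases sgn_eq l with h | h
  · have key := step_half_decagon (l - 4)
    have e : ∀ l : ZMod 10, l - 4 + 1 = l - 3 ∧ l - 4 + 2 = l - 2 ∧ l - 4 + 3 = l - 1 ∧
      l - 4 + 4 = l := by decide
    obtain ⟨e1, e2, e3, e4⟩ := e l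
    rw [e1, e2, e3, e4] at key
    simp only [h, mul_one]
    exact key.symm
  · simp only [h, mul_neg_one, sub_neg_eq_add]
    exact step_half_decagon l

/-- Prepending a letter to an admissible word. -/
theorem Admissible.exists_cons (l : ZMod 10) {w : List (ZMod 10)} (h : Admissible w)
    (hw : Typed (!parity l) w) : ∃ (v : List (ZMod 10)) (k : ℕ), w.length + 1 = v.length + 2 * k ∧
      eval v = step l * eval w ∧ Typed (parity l) v ∧ Admissible v ∧
      (v = l :: w ∨ w = (l + 5) :: v ∨ v.head? = some (l - 4 * sgn l)) := by
  obtain ⟨n, hn⟩ : ∃ n, w.length ≤ n := ⟨_, le_rfl⟩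
  induction n using Nat.strong_induction_on generalizing w with
  | _ n ih =>
  by_cases h1 : w.head? = some (l + 5)
  · obtain ⟨v, rfl⟩ : ∃ v, w = (l + 5) :: v := by cases w <;> simp_all
    refine ⟨v, 1, by simp, ?_, ?_, h.2.2, Or.inr (Or.inl rfl)⟩
    · rw [eval_cons, ← mul_assoc, step_mul_step_add_five, one_mul]
    · simpa using hw.2
  by_cases h2 : [l - sgn l, l - 2 * sgn l, l - 3 * sgn l, l - 4 * sgn l] <+: w
  swap
  · exact ⟨l :: w, 0, by simp, eval_cons _ _, ⟨rfl, hw⟩, ⟨h1, h2, h⟩, Or.inl rfl⟩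
  obtain ⟨r, rfl⟩ := h2
  simp only [List.cons_append, List.nil_append] at h hw hn ⊢
  obtain ⟨-, -, a1, b1, a2, -, a3⟩ := h
  have hr : Typed (!parity l) r := by simpa using hw.2.2.2.2
  simp only [List.length_cons] at hn
  -- Exchanging the half circuits puts `l` directly before the shorter word `r`, so the recursion is
  -- again a prepending of `l`. The three cases for its outcome control how `v` can begin.
  obtain ⟨v, k, hk, hev, htv, hv, hcases⟩ := ih r.length (by lia) a3.2.2 hr le_rfl
  refine ⟨(l - 4 * sgn l) :: (l - 3 * sgn l) :: (l - 2 * sgn l) :: (l - sgn l) :: v, k, ?_, ?_, ?_,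
    ?_, Or.inr (Or.inr rfl)⟩
  · simp only [List.length_cons]; lia
  · rw [← eval_cons, eval_bad_turn]
    simp only [eval_cons, hev]
  · have p : ∀ l : ZMod 10, parity (l - 4 * sgn l) = parity l ∧
      parity (l - 3 * sgn l) = (!parity l) ∧ parity (l - 2 * sgn l) = parity l ∧ parity (l - sgn l) = !parity l := by decide
    obtain ⟨p1, p2, p3, p4⟩ := p l
    simp [Typed, p1, p2, p3, p4, htv]
  have q1 : ∀ l : ZMod 10, l ≠ l - sgn l + 5 ∧ l - 4 * sgn l ≠ l - sgn l + 5 ∧ l - 4 * sgn l ≠ l ∧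
    l - 4 * sgn l + 5 = l + sgn l ∧ l + 5 + 5 = l ∧
    l - 2 * sgn l - sgn (l - 2 * sgn l) = l - 3 * sgn l ∧
    l - 2 * sgn l - 2 * sgn (l - 2 * sgn l) = l - 4 * sgn l ∧
    l - 2 * sgn l - 3 * sgn (l - 2 * sgn l) = l + 5 ∧
    l - 2 * sgn l - 4 * sgn (l - 2 * sgn l) = l - sgn l + 5 := by decide
  have q2 : ∀ l : ZMod 10, l - sgn l - sgn (l - sgn l) = l ∧
    l - sgn l - 2 * sgn (l - sgn l) = l + sgn l ∧
    l - sgn l ≠ l - 2 * sgn l + 5 ∧ l - 2 * sgn l - sgn (l - 2 * sgn l) ≠ l - sgn l ∧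
    l - 2 * sgn l ≠ l - 3 * sgn l + 5 ∧ l - 3 * sgn l - 3 * sgn (l - 3 * sgn l) = l ∧
    l - 3 * sgn l - 4 * sgn (l - 3 * sgn l) = l + sgn l ∧
    l - 3 * sgn l ≠ l - 4 * sgn l + 5 ∧
    l - 4 * sgn l - sgn (l - 4 * sgn l) ≠ l - 3 * sgn l := by decide
  obtain ⟨q11, q12, q13, q14, q15, q16, q17, q18, q19⟩ := q1 l
  obtain ⟨q21, q22, q23, q24, q25, q26, q27, q28, q29⟩ := q2 l
  rw [q16, q17, q18, q19] at b1
  -- No cancellation at the junction: if `l` cancelled against `r`, such a head would complete a bad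
  -- turn in the original word starting at `l - 2 * sgn l`.
  have f1 : v.head? ≠ some (l - sgn l + 5) := by
    rcases hcases with rfl | rfl | h
    · simpa using q11
    · intro hh
      obtain ⟨u, rfl⟩ : ∃ u, v = (l - sgn l + 5) :: u := by cases v <;> simp_all
      exact b1 ⟨u, rfl⟩
    · rw [h]; simpa using q12
  -- Any bad turn crossing the junction would need this prefix. It would give a cancelling pair in
  -- the original word, since `l + sgn l` is inverse to `l - 4 * sgn l`, or contradict the recorded
  -- head of `v`.
  have f2 : ¬ [l, l + sgn l] <+: v := by
    rintro ⟨u, rfl⟩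
    rcases hcases with h | rfl | h
    · obtain rfl : (l + sgn l) :: u = r := by simpa using h
      exact a3.1 (by simp [q14])
    · exact a3.2.2.1 (by simp [q15])
    · exact q13 (by simpa using h.symm)
  refine ⟨?_, ?_, ?_, ?_, ?_, ?_, f1, ?_, hv⟩
  · simpa using q28
  · intro h
    rw [List.cons_prefix_cons] at h
    exact q29 h.1
  · simpa using q25
  · intro h
    simp only [List.cons_prefix_cons, q26, q27] at h
    exact f2 (by simpa using h.2.2)
  · simpa using q23
  · intro h
    rw [List.cons_prefix_cons] at h
    exact q24 h.1
  · intro h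
    rw [q21, q22] at h
    refine f2 (List.IsPrefix.trans ⟨_, rfl⟩ h)

/-- Every word is equivalent to an admissible one which is not longer. -/
theorem exists_admissible {b : Bool} {w : List (ZMod 10)} (hw : Typed b w) :
    ∃ (v : List (ZMod 10)) (k : ℕ), w.length = v.length + 2 * k ∧ eval v = eval w ∧ Typed b v ∧
      Admissible v := by
  induction w generalizing b with
  | nil => exact ⟨[], 0, rfl, rfl, trivial, trivial⟩
  | cons l w ih =>
    obtain ⟨rfl, hw⟩ := hw
    obtain ⟨v, k, hk, he, ht, ha⟩ := ih hw
    obtain ⟨u, j, hj, he', ht', ha', -⟩ := ha.exists_cons l ht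
    exact ⟨u, k + j, by simp only [List.length_cons]; lia, by rw [he', he, eval_cons], ht', ha'⟩

/-! ### Corners of tiles -/

/-- The isometry taking `topVertex` to the `k`-th vertex of the tile `g`, normalized so that tiles
meeting at a vertex give the same isometry. -/
noncomputable def corner (g : SL(2, ℝ)) (k : ℕ) : Motion := toMotion g * rho ^ k * sigma ^ k

theorem corner_smul (g : SL(2, ℝ)) (k : ℕ) : corner g k • topVertex = g • decagonVertex k := by
  have := sigma_zpow_smul k
  rw [zpow_natCast] at this
  rw [corner, mul_smul, this, mul_smul, decagonVertex_eq, toMotion_smul]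

theorem corner_mul_step (g : SL(2, ℝ)) (k : ℕ) :
    corner g k * step (k : ZMod 10) = corner g (k + 1) := by
  have h := step_intCast k
  rw [Int.cast_natCast] at h
  rw [h, corner, corner, ← zpow_natCast sigma, ← zpow_natCast sigma, pow_succ]
  push_cast
  group

theorem corner_succ_mul_step (g : SL(2, ℝ)) (k : ℕ) :
    corner g (k + 1) * step (k + 5 : ZMod 10) = corner g k := by
  rw [← corner_mul_step, mul_assoc, step_mul_step_add_five, mul_one]

theorem corner_congr (g : SL(2, ℝ)) {k l : ℕ} (h : k % 10 = l % 10) : corner g k = corner g l := by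
  have h5 : k % 5 = l % 5 := by lia
  rw [corner, corner, pow_eq_pow_mod k rho_pow_ten, pow_eq_pow_mod l rho_pow_ten, h,
    pow_eq_pow_mod k sigma_pow_five, pow_eq_pow_mod l sigma_pow_five, h5]

theorem corner_mul (g h : SL(2, ℝ)) (k : ℕ) : corner (g * h) k = toMotion g * corner h k := by
  simp only [corner, map_mul, mul_assoc]

theorem rho_smul_ne : rho • topVertex ≠ topVertex := by
  intro h
  have h1 := (beyond_self 1 0).1
  have h2 : step 0 • topVertex = topVertex := by
    rw [step, mul_smul, sigma_zpow_smul, mul_smul, h, sigma_zpow_smul]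
  simp only [height, one_smul, one_mul, h2] at h1
  exact lt_irrefl _ h1

theorem decagonVertex_succ_ne (k : ℕ) : decagonVertex (k + 1) ≠ decagonVertex k := by
  rw [decagonVertex_eq, decagonVertex_eq, pow_succ, mul_smul, Ne, smul_left_cancel_iff]
  exact rho_smul_ne

/-- A side pairing of the decagon, written in terms of the rotations. -/
theorem corner_sidePairing {g : SL(2, ℝ)} {k : ℕ} (h1 : g • decagonVertex (k + 6) = decagonVertex k)
    (h2 : g • decagonVertex (k + 5) = decagonVertex (k + 1)) : corner g (k + 6) = corner 1 k := by
  -- Bring vertex `k + 5` to the top, turn about it by `sigma`, then take it to vertex `k + 1`. This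
  -- pairs the two sides, and an isometry is determined by two points.
  obtain ⟨h, hh⟩ := toMotion_surjective (rho ^ (k + 1) * sigma * (rho ^ (k + 5))⁻¹)
  have e1 : h • decagonVertex (k + 6) = decagonVertex k := by
    rw [← toMotion_smul, hh, decagonVertex_eq, decagonVertex_eq, smul_smul]
    rw [show rho ^ (k + 1) * sigma * (rho ^ (k + 5))⁻¹ * rho ^ (k + 6) =
      rho ^ k * rho * (sigma * rho * sigma) * sigma⁻¹ by group, sigma_rho_sigma,
      mul_inv_cancel_right, mul_smul]
    congr 1
    simpa using sigma_zpow_smul (-1)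
  have e2 : h • decagonVertex (k + 5) = decagonVertex (k + 1) := by
    rw [← toMotion_smul, hh, decagonVertex_eq, decagonVertex_eq, smul_smul, inv_mul_cancel_right,
      mul_smul, sigma_smul]
  have hg : toMotion g = toMotion h := by
    rw [← inv_mul_eq_one, ← map_inv, ← map_mul]
    refine Motion.ext fun z => ?_
    rw [toMotion_smul, one_smul]
    refine smul_eq_self_of_two_fixed (decagonVertex_succ_ne (k + 5)) ?_ ?_ z
    · rw [mul_smul, e1, ← h1, inv_smul_smul]
    · rw [mul_smul, e2, ← h2, inv_smul_smul]
  have h5 := sigma_pow_five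
  rw [corner, corner, map_one, one_mul, hg, hh]
  calc rho ^ (k + 1) * sigma * (rho ^ (k + 5))⁻¹ * rho ^ (k + 6) * sigma ^ (k + 6)
      = rho ^ k * rho * (sigma * rho * sigma) * sigma ^ 5 * sigma ^ k := by
        rw [show k + 6 = k + 5 + 1 by rfl, show sigma ^ (k + 5 + 1) = sigma * sigma ^ 5 * sigma ^ k by
          rw [← pow_succ', ← pow_add]; congr 1; ring]
        group
    _ = rho ^ k * sigma ^ k := by rw [sigma_rho_sigma, h5]; group

/-- The given generators pair the sides with `k < 5`; their inverses serve the other half of the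
boundary. -/
theorem exists_sidePairing (k : ℕ) :
    ∃ g ∈ deckGroup, corner g (k + 6) = corner 1 k := by
  have small : ∀ i : Fin 5, ∃ g ∈ deckGroup, corner g (i + 6) = corner 1 i := by
    intro i
    obtain ⟨h, hh⟩ := toMotion_surjective (corner 1 i * (rho ^ (i.val + 6) * sigma ^ (i.val + 6))⁻¹)
    have e : corner h (i + 6) = corner 1 i := by
      rw [corner, hh, mul_assoc _ (rho ^ _), inv_mul_cancel_right]
    refine ⟨h, Subgroup.subset_closure ⟨i, ?_, ?_⟩, e⟩
    · rw [← corner_smul, e, corner_smul, one_smul]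
    · rw [← corner_smul, ← corner_succ_mul_step, e, show ((i + 5 : ℕ) : ZMod 10) + 5 = (i : ℕ) by
        push_cast; rw [add_assoc, show (5 + 5 : ZMod 10) = 0 from rfl, add_zero], corner_mul_step,
        corner_smul, one_smul]
  by_cases hk : k % 10 < 5
  · obtain ⟨g, hg, e⟩ := small ⟨k % 10, hk⟩
    refine ⟨g, hg, ?_⟩
    rw [corner_congr (k := k + 6) (l := k % 10 + 6) g (by lia),
      corner_congr (k := k) (l := k % 10) 1 (by lia)]
    exact e
  · obtain ⟨g, hg, e⟩ := small ⟨k % 10 - 5, by lia⟩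
    refine ⟨g⁻¹, inv_mem hg, ?_⟩
    have e' : corner g (k + 1) = corner 1 (k + 5) := by
      rw [corner_congr (k := k + 1) (l := (k % 10 - 5) + 6) g (by lia),
        corner_congr (k := k + 5) (l := k % 10 - 5) 1 (by lia)]
      exact e
    have e2 : corner g k = corner 1 (k + 6) := by
      rw [← corner_succ_mul_step, e']
      have := corner_mul_step 1 (k + 5)
      rwa [Nat.cast_add, Nat.cast_ofNat] at this
    have e3 := congrArg (fun X => toMotion g⁻¹ * X) e2
    simp only [← corner_mul, mul_one, inv_mul_cancel] at e3
    exact e3.symm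

/-- The tiles which meet at a vertex. -/
theorem exists_corner_add (g : SL(2, ℝ)) (hg : g ∈ deckGroup) (k n : ℕ) :
    ∃ h ∈ deckGroup, corner h (k + 6 * n) = corner g k := by
  induction n with
  | zero => exact ⟨g, hg, rfl⟩
  | succ n ih =>
    obtain ⟨h, hh, e⟩ := ih
    obtain ⟨s, hs, e'⟩ := exists_sidePairing (k + 6 * n)
    refine ⟨h * s, mul_mem hh hs, ?_⟩
    rw [show k + 6 * (n + 1) = k + 6 * n + 6 by ring, corner_mul, e', ← e, ← corner_mul, mul_one]

/-- `X` takes `topVertex` to a vertex of the tiling of the given parity, and its neighbours to the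
neighbours of that vertex. -/
def IsFrame (b : Bool) (X : Motion) : Prop :=
  ∃ g ∈ deckGroup, ∃ k : ℕ, X = corner g k ∧ parity (k : ZMod 10) = b

/-- The five tiles at a vertex meet it in the corners `k + 6 * n`, which exhaust the residues of one
parity. Every letter of that parity is therefore a side, starting there, of one of these tiles. -/
theorem IsFrame.exists_corner {b : Bool} {X : Motion} (h : IsFrame b X) {m : ZMod 10}
    (hm : parity m = b) : ∃ g ∈ deckGroup, X = corner g m.val := by
  obtain ⟨g, hg, k, rfl, hk⟩ := h
  have key : ∀ m l : ZMod 10, parity l = parity m → ∃ n : Fin 5, l + 6 * (n.val : ZMod 10) = m := by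
    decide
  obtain ⟨n, hn⟩ := key m k (hk.trans hm.symm)
  obtain ⟨h, hh, e⟩ := exists_corner_add g hg k n
  refine ⟨h, hh, ?_⟩
  rw [← e]
  apply corner_congr
  rw [← hn, show (k : ZMod 10) + 6 * (n.val : ZMod 10) = ((k + 6 * n.val : ℕ) : ZMod 10) by
    push_cast; rfl, ZMod.val_natCast, Nat.mod_mod]

theorem parity_add_one (m : ZMod 10) : parity (m + 1) = !parity m := by
  revert m; decide

theorem IsFrame.mul_step {b : Bool} {X : Motion} (h : IsFrame b X) {m : ZMod 10}
    (hm : parity m = b) : IsFrame (!b) (X * step m) := by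
  obtain ⟨g, hg, rfl⟩ := h.exists_corner hm
  refine ⟨g, hg, m.val + 1, ?_, ?_⟩
  · rw [← corner_mul_step, ZMod.natCast_zmod_val]
  · rw [Nat.cast_succ, ZMod.natCast_zmod_val, parity_add_one, hm]

/-! ### Connectedness and uniqueness of frames -/

theorem typed_append (b : Bool) (v w : List (ZMod 10)) :
    Typed b (v ++ w) ↔ Typed b v ∧ Typed (xor b v.length.bodd) w := by
  induction v generalizing b with
  | nil => simp [Typed]
  | cons m v ih => simp [Typed, ih, and_assoc]

theorem eval_append (v w : List (ZMod 10)) : eval (v ++ w) = eval v * eval w := by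
  simp [eval]

/-- There is an edge path from the zeroth vertex of the decagon to the given corner. -/
def Reachable (g : SL(2, ℝ)) (k : ℕ) : Prop :=
  ∃ w, Typed false w ∧ eval w = corner g k ∧ w.length.bodd = parity (k : ZMod 10)

theorem Reachable.all {g : SL(2, ℝ)} {k : ℕ} (h : Reachable g k) (l : ℕ) : Reachable g l := by
  have up : ∀ n, Reachable g (k + n) := by
    intro n
    induction n with
    | zero => exact h
    | succ n ih =>
      obtain ⟨w, hw, e, hp⟩ := ih
      refine ⟨w ++ [((k + n : ℕ) : ZMod 10)], ?_, ?_, ?_⟩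
      · rw [typed_append, Bool.false_xor]
        exact ⟨hw, hp.symm, trivial⟩
      · rw [eval_append, e, eval_cons, eval_nil, mul_one, corner_mul_step, add_assoc]
      · rw [← add_assoc, Nat.cast_succ, parity_add_one, ← hp]; simp
  obtain ⟨w, hw, e, hp⟩ := up (l + 9 * k)
  have hc : k + (l + 9 * k) = l + 10 * k := by ring
  refine ⟨w, hw, e.trans (corner_congr _ (by lia)), hp.trans ?_⟩
  rw [hc]
  push_cast
  rw [show (10 : ZMod 10) = 0 from rfl, zero_mul, add_zero]

/-- Connectedness of the one-skeleton: multiplying by a generator on the right passes to a tile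
sharing a corner, with the same frame there. -/
theorem reachable_of_mem {g : SL(2, ℝ)} (hg : g ∈ deckGroup) : ∀ k, Reachable g k := by
  have swap : ∀ {g h : SL(2, ℝ)} {k l : ℕ}, corner g k = corner h l →
      parity (k : ZMod 10) = parity (l : ZMod 10) → Reachable h l → Reachable g k := by
    rintro g h k l e hp ⟨w, hw, e', hp'⟩
    exact ⟨w, hw, e'.trans e.symm, hp'.trans hp.symm⟩
  have par : ∀ k : ℕ, parity ((k + 6 : ℕ) : ZMod 10) = parity (k : ZMod 10) := by
    have : ∀ m : ZMod 10, parity (m + 6) = parity m := by decide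
    intro k; rw [Nat.cast_add]; exact this k
  induction hg using Subgroup.closure_induction_right with
  | one =>
    have : Reachable 1 0 := ⟨[], trivial, by simp [eval, corner], by decide⟩
    exact this.all
  | mul_right x hx y hy ih =>
    obtain ⟨i, h1, h2⟩ := hy
    have e := corner_sidePairing h1 h2
    refine (swap (k := i + 6) ?_ (par i) (ih i)).all
    rw [corner_mul, e, ← corner_mul, mul_one]
  | mul_inv_cancel x hx y hy ih =>
    obtain ⟨i, h1, h2⟩ := hy
    have e := corner_sidePairing h1 h2
    refine (swap (k := i) ?_ (par i).symm (ih (i + 6))).all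
    have e2 := congrArg (fun X => toMotion (x * y⁻¹) * X) e
    simp only [← corner_mul, mul_one, inv_mul_cancel_right] at e2
    exact e2.symm

theorem IsFrame.exists_word {b : Bool} {X : Motion} (h : IsFrame b X) :
    ∃ w, Typed false w ∧ Admissible w ∧ eval w = X ∧ w.length.bodd = b := by
  obtain ⟨g, hg, k, rfl, rfl⟩ := h
  obtain ⟨w, hw, e, hp⟩ := reachable_of_mem hg k
  obtain ⟨v, n, hv, e', ht, ha⟩ := exists_admissible hw
  refine ⟨v, ht, ha, e'.trans e, ?_⟩
  rw [← hp, hv]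
  simp

/-- A vertex of the tiling determines its frame. -/
theorem IsFrame.unique {b c : Bool} {X Y : Motion} (hX : IsFrame b X) (hY : IsFrame c Y)
    (h : X • topVertex = Y • topVertex) : X = Y ∧ b = c := by
  obtain ⟨v, tv, av, rfl, rfl⟩ := hX.exists_word
  obtain ⟨w, tw, aw, rfl, rfl⟩ := hY.exists_word
  -- Both frames are values of admissible words read from one base vertex, so uniqueness of words
  -- makes frame and parity well defined.
  rw [av.eq_of_smul_eq aw tv tw h]
  exact ⟨rfl, rfl⟩

theorem IsFrame.mul_eval {b : Bool} {X : Motion} (h : IsFrame b X) {w : List (ZMod 10)}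
    (hw : Typed b w) : IsFrame (xor b w.length.bodd) (X * eval w) := by
  induction w generalizing b X with
  | nil => simpa [eval_nil] using h
  | cons m w ih =>
    have := ih (h.mul_step hw.1) hw.2
    rw [eval_cons, ← mul_assoc]
    simpa using this

theorem parity_add_five (m : ZMod 10) : parity (m + 5) = !parity m := by
  revert m; decide

theorem Typed.exists_inverse {b : Bool} {v : List (ZMod 10)} (h : Typed b v) :
    ∃ w, Typed (xor b v.length.bodd) w ∧ w.length = v.length ∧ eval v * eval w = 1 := by
  induction v generalizing b with
  | nil => exact ⟨[], trivial, rfl, by rw [eval_nil, one_mul]⟩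
  | cons m v ih =>
    obtain ⟨w, hw, hl, he⟩ := ih h.2
    refine ⟨w ++ [m + 5], ?_, by simp [hl], ?_⟩
    · rw [typed_append, hl]
      refine ⟨by simpa using hw, ?_, trivial⟩
      rw [parity_add_five, h.1]
      simp
    · rw [eval_append, eval_cons, eval_cons, eval_nil, mul_one, mul_assoc, ← mul_assoc (eval v), he,
        one_mul, step_mul_step_add_five]

/-- Any two frames are connected by a word. -/
theorem IsFrame.exists_typed {b c : Bool} {X Y : Motion} (hX : IsFrame b X) (hY : IsFrame c Y) :
    ∃ w, Typed b w ∧ X * eval w = Y := by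
  obtain ⟨v, tv, -, rfl, rfl⟩ := hX.exists_word
  obtain ⟨w, tw, -, rfl, rfl⟩ := hY.exists_word
  obtain ⟨u, tu, hl, he⟩ := tv.exists_inverse
  rw [Bool.false_xor] at tu
  refine ⟨u ++ w, ?_, by rw [eval_append, ← mul_assoc, he, one_mul]⟩
  rw [typed_append, hl, Bool.xor_self]
  exact ⟨tu, tw⟩

/-! ### Edges of the tiling -/

/-- The number of a letter. -/
def encode (l : Letter) : ZMod 10 := if l.2 then (l.1.val : ZMod 10) else (l.1.val : ZMod 10) + 5

theorem isFrame_corner {g : SL(2, ℝ)} (hg : g ∈ deckGroup) (k : ℕ) {b : Bool}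
    (hb : parity (k : ZMod 10) = b) : IsFrame b (corner g k) := ⟨g, hg, k, rfl, hb⟩

/-- Translates edges, given by two sides of a decagon per label, into right multiplication of frames
by `step`. -/
theorem isStep_iff (l : Letter) (p q : ℍ) : IsStep l p q ↔
    ∃ X, IsFrame (parity (encode l)) X ∧ p = X • topVertex ∧
      q = (X * step (encode l)) • topVertex := by
  have par : ∀ i : Fin 5, parity ((i.val + 6 : ℕ) : ZMod 10) = parity (i.val : ZMod 10) ∧
      parity ((i.val + 1 : ℕ) : ZMod 10) = parity ((i.val : ZMod 10) + 5) ∧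
      parity ((i.val + 5 : ℕ) : ZMod 10) = parity ((i.val : ZMod 10) + 5) ∧
      ((i.val + 5 : ℕ) : ZMod 10) + 5 = (i.val : ZMod 10) ∧
      ((i.val + 5 : ℕ) : ZMod 10) = (i.val : ZMod 10) + 5 ∧
      (i.val : ZMod 10).val = i.val ∧ ((i.val : ZMod 10) + 5).val = i.val + 5 := by decide
  obtain ⟨i, s⟩ := l
  obtain ⟨p1, p2, p3, p4, p5, p6, p7⟩ := par i
  cases s with
  | true =>
    simp only [IsStep, encode, if_true]
    constructor
    · rintro ⟨g, hg, ⟨rfl, rfl⟩ | ⟨rfl, rfl⟩⟩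
      · exact ⟨corner g i, isFrame_corner hg _ rfl, (corner_smul _ _).symm,
          by rw [corner_mul_step, corner_smul]⟩
      · refine ⟨corner g (i + 6), isFrame_corner hg _ p1, (corner_smul _ _).symm, ?_⟩
        have := corner_succ_mul_step g (i + 5)
        rw [p4] at this
        rw [this, corner_smul]
    · rintro ⟨X, hX, rfl, rfl⟩
      obtain ⟨g, hg, rfl⟩ := hX.exists_corner rfl
      rw [p6]
      exact ⟨g, hg, Or.inl ⟨corner_smul _ _, by rw [corner_mul_step, corner_smul]⟩⟩
  | false =>
    simp only [IsStep, encode, Bool.false_eq_true, if_false]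
    constructor
    · rintro ⟨g, hg, ⟨rfl, rfl⟩ | ⟨rfl, rfl⟩⟩
      · exact ⟨corner g (i + 1), isFrame_corner hg _ p2, (corner_smul _ _).symm,
          by rw [corner_succ_mul_step, corner_smul]⟩
      · refine ⟨corner g (i + 5), isFrame_corner hg _ p3, (corner_smul _ _).symm, ?_⟩
        rw [← p5, corner_mul_step, corner_smul]
    · rintro ⟨X, hX, rfl, rfl⟩
      obtain ⟨g, hg, rfl⟩ := hX.exists_corner rfl
      rw [p7]
      exact ⟨g, hg, Or.inr ⟨by rw [← p5, corner_mul_step, corner_smul], corner_smul _ _⟩⟩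

/-! ### Well-tempered words -/

/-- Freely reduced words in the letters which contain no bad turn. -/
def WellTemperedWord (w : List Letter) : Prop :=
  FreeGroup.IsReduced w ∧ ∀ t ∈ badTurns, ¬ t <:+: w

theorem encode_injective : Function.Injective encode := by
  have : ∀ l l' : Letter, encode l = encode l' → l = l' := by decide
  exact fun l l' => this l l'

theorem encode_surjective : Function.Surjective encode := by
  have : ∀ m : ZMod 10, ∃ l : Letter, encode l = m := by decide
  exact this

/-- Each letter begins exactly one bad turn, the half circuit in the direction given by its parity.
-/
theorem badTurns_eq (l : Letter) (t : List Letter) :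
    l :: t ∈ badTurns ↔ t.map encode = [encode l - sgn (encode l), encode l - 2 * sgn (encode l),
      encode l - 3 * sgn (encode l), encode l - 4 * sgn (encode l)] := by
  have h1 : ∀ u ∈ badTurns, ∀ x ∈ u.head?, u.tail.map encode = [encode x - sgn (encode x),
      encode x - 2 * sgn (encode x), encode x - 3 * sgn (encode x),
      encode x - 4 * sgn (encode x)] := by decide
  have h2 : ∀ x : Letter, ∃ u ∈ badTurns, u.head? = some x := by decide
  constructor
  · intro h
    exact h1 _ h l rfl
  · intro h
    obtain ⟨u, hu, hx⟩ := h2 l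
    obtain ⟨u, rfl⟩ : ∃ v, u = l :: v := by cases u <;> simp_all
    have := h1 _ hu l rfl
    rw [← h] at this
    rwa [← List.map_injective_iff.2 encode_injective this]

theorem wellTemperedWord_iff (w : List Letter) :
    WellTemperedWord w ↔ Admissible (w.map encode) := by
  induction w with
  | nil =>
    have : ∀ t ∈ badTurns, t ≠ [] := by decide
    simpa [WellTemperedWord, Admissible] using this
  | cons l w ih =>
    have hinv : ∀ l l' : Letter, (l.1 = l'.1 → l.2 = l'.2) ↔ encode l' ≠ encode l + 5 := by decide
    have e1 : (∀ y ∈ w.head?, l.1 = y.1 → l.2 = y.2) ↔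
        (w.map encode).head? ≠ some (encode l + 5) := by
      cases w with
      | nil => simp
      | cons y w => simpa using hinv l y
    have e2 : (∀ t ∈ badTurns, ¬ t <+: l :: w) ↔
        ¬ [encode l - sgn (encode l), encode l - 2 * sgn (encode l),
          encode l - 3 * sgn (encode l), encode l - 4 * sgn (encode l)] <+: w.map encode := by
      constructor
      · intro h hp
        obtain ⟨t, ht, e⟩ := List.prefix_map_iff.1 hp
        exact h (l :: t) ((badTurns_eq l t).2 e.symm) (List.cons_prefix_cons.2 ⟨rfl, ht⟩)
      · intro h t ht hp
        cases t with
        | nil => exact absurd ht (by decide)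
        | cons x t =>
          obtain ⟨rfl, hp'⟩ := List.cons_prefix_cons.1 hp
          rw [← (badTurns_eq x t).1 ht] at h
          exact h (hp'.map _)
    rw [List.map_cons, Admissible, ← ih, ← e1, ← e2, WellTemperedWord, WellTemperedWord,
      FreeGroup.IsReduced, FreeGroup.IsReduced, List.isChain_cons]
    simp only [List.infix_cons_iff, not_or]
    constructor
    · rintro ⟨⟨a, b⟩, c⟩
      exact ⟨a, fun t ht => (c t ht).1, b, fun t ht => (c t ht).2⟩
    · rintro ⟨a, c, b, d⟩
      exact ⟨⟨a, b⟩, fun t ht => ⟨c t ht, d t ht⟩⟩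

theorem WellTemperedWord.infix {v w : List Letter} (hw : WellTemperedWord w) (h : v <:+: w) :
    WellTemperedWord v :=
  ⟨hw.1.infix h, fun t ht hv => hw.2 t ht (hv.trans h)⟩

theorem WellTemperedWord.invRev {w : List Letter} (hw : WellTemperedWord w) :
    WellTemperedWord (FreeGroup.invRev w) := by
  refine ⟨?_, fun t ht h => ?_⟩
  · rw [FreeGroup.IsReduced, FreeGroup.invRev, List.isChain_reverse, List.isChain_map]
    refine List.IsChain.imp (fun a b h => ?_) hw.1
    intro h'
    simp only at h' ⊢
    rw [h h'.symm]
  · have bad : ∀ t ∈ badTurns, FreeGroup.invRev t ∈ badTurns := by decide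
    refine hw.2 _ (bad t ht) ?_
    rw [← FreeGroup.invRev_invRev (L₁ := w)]
    exact List.reverse_infix.2 (h.map _)

theorem wellTemperedWord_of_short {w : List Letter}
    (h : ∀ v, v <:+: w → v.length ≤ 5 → WellTemperedWord v) : WellTemperedWord w := by
  refine ⟨?_, fun t ht hw => ?_⟩
  · induction w with
    | nil => exact FreeGroup.IsReduced.nil
    | cons x w ih =>
      cases w with
      | nil => exact FreeGroup.IsReduced.singleton
      | cons y w =>
        have hxy := (h [x, y] ⟨[], w, rfl⟩ (by simp)).1
        rw [FreeGroup.isReduced_cons_cons] at hxy ⊢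
        exact ⟨hxy.1, ih fun v hv => h v (List.infix_cons hv)⟩
  · have five : ∀ t ∈ badTurns, t.length ≤ 5 := by decide
    exact (h t hw (five t ht)).2 t ht List.infix_rfl

theorem exists_infix_of_length_le {α : Type*} {v w : List α} {n : ℕ} (h : v <:+: w)
    (hv : v.length ≤ n) (hw : n ≤ w.length) : ∃ u, v <:+: u ∧ u <:+: w ∧ u.length = n := by
  obtain ⟨a, b, rfl⟩ := h
  simp only [List.length_append] at hw
  -- Extend to the right as far as needed or possible, and make up the rest on the left.
  refine ⟨a.drop (a.length - (n - v.length - (b.length ⊓ (n - v.length)))) ++ v ++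
    b.take (n - v.length), ⟨_, _, rfl⟩, ⟨a.take (a.length - (n - v.length -
      (b.length ⊓ (n - v.length)))), b.drop (n - v.length), ?_⟩, ?_⟩
  · simp only [← List.append_assoc, List.take_append_drop]
    rw [List.append_assoc _ (b.take _), List.take_append_drop]
  · simp only [List.length_append, List.length_drop, List.length_take]
    lia

theorem wellTemperedWord_of_length_eq {w : List Letter} (hw : 5 ≤ w.length)
    (h : ∀ v, v <:+: w → v.length = 5 → WellTemperedWord v) : WellTemperedWord w := by
  refine wellTemperedWord_of_short fun v hv hl => ?_
  obtain ⟨u, h1, h2, h3⟩ := exists_infix_of_length_le hv hl hw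
  exact (h u h2 h3).infix h1

/-! ### Edge paths and their words -/

theorem wellTempered_iff {p q : Vertex} (γ : Quiver.Path p q) :
    WellTempered γ ↔ WellTemperedWord (word γ) := Iff.rfl

theorem length_word {p q : Vertex} (γ : Quiver.Path p q) : (word γ).length = γ.length := by
  induction γ with
  | nil => rfl
  | cons γ e ih => simp [word, ih]

theorem word_comp {p q r : Vertex} (α : Quiver.Path p q) (β : Quiver.Path q r) :
    word (α.comp β) = word α ++ word β := by
  induction β with
  | nil => simp [word]
  | cons β e ih => rw [Quiver.Path.comp_cons, word, word, ih, List.append_assoc]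

theorem word_reverse {p q : Vertex} (γ : Quiver.Path p q) :
    word γ.reverse = FreeGroup.invRev (word γ) := by
  induction γ with
  | nil => rfl
  | cons γ e ih =>
    rw [Quiver.Path.reverse, word_comp, ih, word]
    simp [FreeGroup.invRev, Quiver.Hom.toPath, word, Quiver.reverse, Quiver.HasReverse.reverse']

theorem IsSubpath.infix {p q r s : Vertex} {β : Quiver.Path p q} {γ : Quiver.Path r s}
    (h : IsSubpath β γ) : word β <:+: word γ := by
  obtain ⟨α, δ, rfl⟩ := h
  exact ⟨word α, word δ, by rw [word_comp, word_comp]⟩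

theorem exists_comp_of_word_eq_append {p q : Vertex} (γ : Quiver.Path p q) {u v : List Letter}
    (h : word γ = u ++ v) : ∃ (r : Vertex) (α : Quiver.Path p r) (β : Quiver.Path r q),
      γ = α.comp β ∧ word α = u ∧ word β = v := by
  induction γ generalizing v with
  | nil =>
    obtain ⟨rfl, rfl⟩ := List.append_eq_nil_iff.1 h.symm
    exact ⟨_, Quiver.Path.nil, Quiver.Path.nil, rfl, rfl, rfl⟩
  | cons γ e ih =>
    rcases List.eq_nil_or_concat v with rfl | ⟨v, l, rfl⟩
    · rw [List.append_nil] at h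
      exact ⟨_, γ.cons e, Quiver.Path.nil, rfl, h, rfl⟩
    · rw [List.concat_eq_append] at h ⊢
      rw [word, ← List.append_assoc] at h
      obtain ⟨h1, h2⟩ := List.append_inj' h rfl
      obtain ⟨r, α, β, rfl, h3, h4⟩ := ih h1
      exact ⟨r, α, β.cons e, rfl, h3, by rw [word, h4, h2]⟩

theorem exists_subpath_of_infix {p q : Vertex} (γ : Quiver.Path p q) {v : List Letter}
    (h : v <:+: word γ) : ∃ (r s : Vertex) (β : Quiver.Path r s), IsSubpath β γ ∧ word β = v := by
  obtain ⟨a, b, h⟩ := h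
  obtain ⟨s, α, δ, rfl, h1, -⟩ := exists_comp_of_word_eq_append γ h.symm
  obtain ⟨r, α, β, rfl, -, h2⟩ := exists_comp_of_word_eq_append α h1
  exact ⟨r, s, β, ⟨α, δ, rfl⟩, h2⟩

theorem Vertex.exists_frame (p : Vertex) : ∃ b X, IsFrame b X ∧ p.1 = X • topVertex := by
  obtain ⟨g, hg, k, hk⟩ := p.2
  exact ⟨_, corner g k, isFrame_corner hg k rfl, by rw [hk, corner_smul]⟩

theorem IsFrame.exists_vertex {b : Bool} {X : Motion} (h : IsFrame b X) :
    ∃ p : Vertex, p.1 = X • topVertex := by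
  obtain ⟨g, hg, k, rfl, -⟩ := h
  exact ⟨⟨_, g, hg, k, corner_smul g k⟩, rfl⟩

/-- The word of a path determines its end. -/
theorem typed_word {p q : Vertex} (γ : Quiver.Path p q) {b : Bool} {X : Motion} (hX : IsFrame b X)
    (hp : p.1 = X • topVertex) : Typed b ((word γ).map encode) ∧
      q.1 = (X * eval ((word γ).map encode)) • topVertex := by
  induction γ with
  | nil => exact ⟨trivial, by simpa [word, eval] using hp⟩
  | cons γ e ih =>
    obtain ⟨ht, hr⟩ := ih
    obtain ⟨l, hl⟩ := e
    obtain ⟨Y, hY, h1, h2⟩ := (isStep_iff l _ _).1 hl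
    -- The frame witnessing the last edge must be the one carried along the path so far.
    obtain ⟨rfl, hb⟩ := hY.unique (hX.mul_eval ht) (h1.symm.trans hr)
    rw [word, List.map_append, List.map_singleton]
    refine ⟨(typed_append _ _ _).2 ⟨ht, hb, trivial⟩, ?_⟩
    refine h2.trans ?_
    rw [eval_append, eval_cons, eval_nil, mul_one, mul_assoc]

theorem exists_path {b : Bool} {X : Motion} (hX : IsFrame b X) {p q : Vertex}
    (hp : p.1 = X • topVertex) {w : List Letter} (hw : Typed b (w.map encode))
    (hq : q.1 = (X * eval (w.map encode)) • topVertex) : ∃ γ : Quiver.Path p q, word γ = w := by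
  induction w generalizing b X p with
  | nil =>
    obtain rfl : p = q := Subtype.ext (by rw [hp, hq]; simp [eval])
    exact ⟨Quiver.Path.nil, rfl⟩
  | cons l w ih =>
    have hX' := hX.mul_step hw.1
    obtain ⟨r, hr⟩ := hX'.exists_vertex
    rw [List.map_cons, eval_cons, ← mul_assoc] at hq
    obtain ⟨γ, hγ⟩ := ih hX' hr hw.2 hq
    have hl : IsStep l p.1 r.1 := (isStep_iff l _ _).2 ⟨X, hw.1 ▸ hX, hp, hr⟩
    let e : p ⟶ r := ⟨l, hl⟩
    exact ⟨e.toPath.comp γ, by rw [word_comp, hγ]; rfl⟩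

/-- The intermediate vertices are recovered from the starting frame and the prefixes of the word. -/
theorem word_injective {p q : Vertex} {γ δ : Quiver.Path p q} (h : word γ = word δ) : γ = δ := by
  obtain ⟨b, X, hX, hp⟩ := p.exists_frame
  induction γ with
  | nil =>
    cases δ with
    | nil => rfl
    | cons δ f => simp [word] at h
  | cons γ e ih =>
    cases δ with
    | nil => simp [word] at h
    | cons δ f =>
      rw [word, word] at h
      obtain ⟨h1, h2⟩ := List.append_inj' h rfl
      have hr := (typed_word γ hX hp).2
      rw [h1, ← (typed_word δ hX hp).2] at hr
      obtain rfl := Subtype.ext hr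
      rw [ih h1, Subtype.ext (by simpa using h2 : e.1 = f.1)]

/-! ### Existence, uniqueness and minimal length for paths -/

theorem WellTempered.word_eq {p q : Vertex} {γ : Quiver.Path p q} (hγ : WellTempered γ) {b : Bool}
    {X : Motion} (hX : IsFrame b X) (hp : p.1 = X • topVertex) {v : List (ZMod 10)}
    (hv : Admissible v) (tv : Typed b v) (hq : q.1 = (X * eval v) • topVertex) :
    (word γ).map encode = v := by
  obtain ⟨ht, he⟩ := typed_word γ hX hp
  refine ((wellTemperedWord_iff _).1 hγ).eq_of_smul_eq hv ht tv ?_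
  rw [hq, mul_smul, mul_smul, smul_left_cancel_iff] at he
  exact he.symm

theorem existsUnique_wellTempered (p q : Vertex) : ∃! γ : Quiver.Path p q, WellTempered γ := by
  obtain ⟨b, X, hX, hp⟩ := p.exists_frame
  obtain ⟨c, Y, hY, hq⟩ := q.exists_frame
  obtain ⟨w, tw, rfl⟩ := hX.exists_typed hY
  obtain ⟨v, -, -, he, tv, hv⟩ := exists_admissible tw
  obtain ⟨u, rfl⟩ := List.map_surjective_iff.2 encode_surjective v
  rw [← he] at hq
  obtain ⟨γ, rfl⟩ := exists_path hX hp tv hq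
  refine ⟨γ, (wellTemperedWord_iff _).2 hv, fun δ hδ => word_injective ?_⟩
  exact List.map_injective_iff.2 encode_injective (WellTempered.word_eq hδ hX hp hv tv hq)

/-- Reducing the word of any competitor gives an admissible word that is no longer, and by
uniqueness this is the word of `γ`. -/
theorem WellTempered.isGeodesic {p q : Vertex} {γ : Quiver.Path p q} (h : WellTempered γ) :
    IsGeodesic γ := by
  intro δ
  obtain ⟨b, X, hX, hp⟩ := p.exists_frame
  obtain ⟨tδ, hq⟩ := typed_word δ hX hp
  obtain ⟨v, k, hk, he, tv, hv⟩ := exists_admissible tδ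
  rw [← he] at hq
  have hw := congrArg List.length (WellTempered.word_eq h hX hp hv tv hq)
  rw [List.length_map, length_word] at hw hk
  lia

end DecagonTiling

open DecagonTiling in
theorem theoremA1 :
    -- existence and uniqueness
    (∀ p q : Vertex, ∃! γ : Quiver.Path p q, WellTempered γ) ∧
    -- well-tempered paths are geodesic
    (∀ (p q : Vertex) (γ : Quiver.Path p q), WellTempered γ → IsGeodesic γ) ∧
    -- subpaths of well-tempered paths are well-tempered
    (∀ (p q r s : Vertex) (γ : Quiver.Path p q) (β : Quiver.Path r s),
      WellTempered γ → IsSubpath β γ → WellTempered β) ∧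
    -- inverses of well-tempered paths are well-tempered
    (∀ (p q : Vertex) (γ : Quiver.Path p q), WellTempered γ → WellTempered γ.reverse) ∧
    -- local detectability: subpaths of length at most five suffice, and for a path of length
    -- at least five those of length exactly five do
    (∀ (p q : Vertex) (γ : Quiver.Path p q),
      WellTempered γ ↔ ∀ (r s : Vertex) (β : Quiver.Path r s),
        IsSubpath β γ → β.length ≤ 5 → WellTempered β) ∧
    (∀ (p q : Vertex) (γ : Quiver.Path p q), 5 ≤ γ.length →
      (WellTempered γ ↔ ∀ (r s : Vertex) (β : Quiver.Path r s),
        IsSubpath β γ → β.length = 5 → WellTempered β)) := by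
  have sub : ∀ (p q r s : Vertex) (γ : Quiver.Path p q) (β : Quiver.Path r s),
      WellTempered γ → IsSubpath β γ → WellTempered β := fun p q r s γ β hγ hβ =>
    WellTemperedWord.infix hγ hβ.infix
  refine ⟨existsUnique_wellTempered, fun p q γ h => h.isGeodesic, sub, fun p q γ h => ?_,
    fun p q γ => ⟨fun h r s β hβ _ => sub _ _ _ _ γ β h hβ, fun h => ?_⟩,
    fun p q γ hγ => ⟨fun h r s β hβ _ => sub _ _ _ _ γ β h hβ, fun h => ?_⟩⟩
  · rw [wellTempered_iff, word_reverse]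
    exact WellTemperedWord.invRev h
  · refine wellTemperedWord_of_short fun v hv hl => ?_
    obtain ⟨r, s, β, hβ, rfl⟩ := exists_subpath_of_infix γ hv
    exact h r s β hβ (by rwa [← length_word])
  · refine wellTemperedWord_of_length_eq (by rwa [length_word]) fun v hv hl => ?_
    obtain ⟨r, s, β, hβ, rfl⟩ := exists_subpath_of_infix γ hv
    exact h r s β hβ (by rwa [← length_word])
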